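/- Let $B$ be a real symmetric positive-definite $n\times n$ matrix, write $\langle v,w\rangle_B=\langle Bv,w\rangle$ and $\|v\|_B^2=\langle v,v\rangle_B$, and consider the flat torus $\mathbb{T}^n=\mathbb{R}^n/\mathbb{Z}^n$ with the metric given by $B$, whose Laplacian is $\Delta_B f=\sum_{j,l}(B^{-1})_{jl}\,\partial^2 f/\partial x_j\partial x_l$. Let $k\ge 1$, let $\mu_1,\dots,\mu_k\in\mathbb{R}$, and let $\mathcal{V}_1,\dots,\mathcal{V}_k\subset\mathbb{R}^n$ be finite nonempty sets such that for every $r$ and every $v\in\mathcal{V}_r$ the vector $Bv$ has integer components and $\|v\|_B^2=\mu_r/(2\pi)^2$. Assume that $v+w\ne 0$ for all $v\in\mathcal{V}_r$, $w\in\mathcal{V}_s$ and all $r,s$ (including $r=s$ and $v=w$), and that $\mathcal{V}_r\cap\mathcal{V}_s=\emptyset$ for $r\ne s$. Let $a^{(1)},\dots,a^{(k)}$ be independent random vectors, with $a^{(r)}=(a_v)_{v\in\mathcal{V}_r}$ uniformly distributed on the sphere of radius $\sqrt2$ centred at $0$ in $\mathbb{R}^{|\mathcal{V}_r|}$, and set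 $$f_r(x)=\operatorname{Re}\Big(\sum_{v\in\mathcal{V}_r}a_v\,e^{2\pi i\langle Bv,x\rangle}\Big),\qquad x\in\mathbb{T}^n.$$ Then $\Delta_B f_r=-\mu_r f_r$ for each $r$, and almost surely $f_1,\dots,f_k$ are orthonormal in $L_2(\mathbb{T}^n)$ with respect to the uniform probability measure. For fixed coefficients let $W=(f_1(X),\dots,f_k(X))$, where $X$ is a uniformly distributed random point of $\mathbb{T}^n$, let $Z$ be a standard Gaussian random vector in $\mathbb{R}^k$, and let $d_W(W,Z)=\sup_g|\mathbb{E}g(W)-\mathbb{E}g(Z)|$, the supremum being over all $g:\mathbb{R}^k\to\mathbb{R}$ with Lipschitz constant at most $1$ for the Euclidean norm. Then $d_W(W,Z)$ is a measurable function of the randomness of the coefficients (up to a null set), and its expectation $\mathbb{E}_a$ over the coefficients satisfies $$\mathbb{E}_a\,d_W(W,Z)\le\frac{4\pi^2}{\min_r\mu_r}\sqrt{\sum_{r,s=1}^k\frac{2}{|\mathcal{V}_r||\mathcal{V}_s|}\sum_{v\in\mathcal{V}_r,\;w\in\mathcal{V}_s}\langle v,w\rangle_B^2}.$$ -/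

import Mathlib

open MeasureTheory ProbabilityTheory
open scoped Matrix ENNReal

noncomputable section

/-- The Wasserstein distance of two probability laws: the supremum of `|𝔼 g(X) - 𝔼 g(Y)|` over all
`g` with Lipschitz constant at most `1`. -/
def wassersteinDist {E : Type*} [PseudoEMetricSpace E] [MeasurableSpace E]
    (μ ν : Measure E) : ℝ≥0∞ :=
  ⨆ (g : E → ℝ) (_ : LipschitzWith 1 g), ENNReal.ofReal |(∫ x, g x ∂μ) - ∫ x, g x ∂ν|

/-- The uniform probability measure on the sphere of radius `ρ` about `0` in `ℝ^ι`
(for nonempty `ι`): the image under `u ↦ ρ u` of normalized surface measure on the unit sphere. -/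
def uniformSphere (ι : Type*) [Fintype ι] (ρ : ℝ) : Measure (EuclideanSpace ℝ ι) :=
  (((volume : Measure (EuclideanSpace ℝ ι)).toSphere Set.univ)⁻¹ •
    (volume : Measure (EuclideanSpace ℝ ι)).toSphere).map
      (fun u : Metric.sphere (0 : EuclideanSpace ℝ ι) 1 => ρ • (u : EuclideanSpace ℝ ι))

/-- The bilinear form `⟨v, w⟩_B = ⟨B v, w⟩`. -/
def bilinB {n : ℕ} (B : Matrix (Fin n) (Fin n) ℝ) (v w : Fin n → ℝ) : ℝ :=
  (B *ᵥ v) ⬝ᵥ w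

/-- The quotient map `ℝⁿ → ℝⁿ / ℤⁿ`. -/
def torusProj {n : ℕ} (y : Fin n → ℝ) : UnitAddTorus (Fin n) :=
  fun i => (y i : UnitAddCircle)

/-- The representative in `[0, 1)ⁿ` of a point of `ℝⁿ / ℤⁿ`. -/
def torusRep {n : ℕ} (x : UnitAddTorus (Fin n)) : Fin n → ℝ :=
  fun i => (AddCircle.equivIco 1 0 (x i) : ℝ)

/-- The Laplacian of the flat metric `B`, in the coordinates of `ℝⁿ`:
`Δ_B F = ∑ j k, (B⁻¹)_{jk} ∂²F / ∂x_j ∂x_k`. -/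
def flatLaplacian {n : ℕ} (B : Matrix (Fin n) (Fin n) ℝ) (F : (Fin n → ℝ) → ℝ)
    (x : Fin n → ℝ) : ℝ :=
  ∑ j, ∑ k, B⁻¹ j k *
    fderiv ℝ (fun y => fderiv ℝ F y (Pi.single k 1)) x (Pi.single j 1)

/-- The function `x ↦ Re ∑_{v ∈ V} a_v exp (2 π i ⟨B v, x⟩)` on `ℝⁿ`. -/
def trigSum {n : ℕ} (B : Matrix (Fin n) (Fin n) ℝ) (V : Finset (Fin n → ℝ))
    (a : EuclideanSpace ℝ V) (x : Fin n → ℝ) : ℝ :=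
  (∑ v : V, (a v : ℂ) *
    Complex.exp (2 * Real.pi * Complex.I * ((bilinB B v x : ℝ) : ℂ))).re

/-- The function which `trigSum` induces on `ℝⁿ / ℤⁿ` when every `B v`, `v ∈ V`, is an integer
vector; see `torusFun_torusProj`. -/
def torusFun {n : ℕ} (B : Matrix (Fin n) (Fin n) ℝ) (V : Finset (Fin n → ℝ))
    (a : EuclideanSpace ℝ V) (x : UnitAddTorus (Fin n)) : ℝ :=
  trigSum B V a (torusRep x)

/-- `torusFun` does not depend on the choice of representatives. -/
theorem torusFun_torusProj {n : ℕ} (B : Matrix (Fin n) (Fin n) ℝ) (V : Finset (Fin n → ℝ))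
    (hint : ∀ v ∈ V, ∀ i, ∃ m : ℤ, (B *ᵥ v) i = m) (a : EuclideanSpace ℝ V)
    (y : Fin n → ℝ) : torusFun B V a (torusProj y) = trigSum B V a y := by
  have hrep : ∀ i, ∃ l : ℤ, torusRep (torusProj y) i = y i + l := by
    intro i
    refine ⟨-⌊y i⌋, ?_⟩
    have h : torusRep (torusProj y) i = Int.fract (y i) := by
      simp only [torusRep, torusProj]
      rw [AddCircle.coe_equivIco_mk_apply]
      simp
    rw [h, Int.fract]
    push_cast
    ring
  choose l hl using hrep
  unfold torusFun trigSum
  congr 1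
  refine Finset.sum_congr rfl fun v _ => ?_
  congr 1
  choose m hm using hint v v.2
  have hb : bilinB B v (torusRep (torusProj y)) =
      bilinB B v y + ((∑ i, m i * l i : ℤ) : ℝ) := by
    simp only [bilinB, dotProduct]
    push_cast
    rw [← Finset.sum_add_distrib]
    refine Finset.sum_congr rfl fun i _ => ?_
    rw [hl i, hm i]
    ring
  rw [hb, Complex.exp_eq_exp_iff_exists_int]
  refine ⟨∑ i, m i * l i, ?_⟩
  push_cast
  ring

end

/-! The proof combines Stein's method with an average over the coefficients. Write F = (f_1, …,
f_k). Since Δ_B f_r = -μ_r f_r, integration by parts on the torus gives 𝔼[f_r φ(F)] = 𝔼[∑_s A_{rs}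
∂_s φ(F)] with A_{rs} = ⟨∇f_r, ∇f_s⟩ / μ_r. For a standard Gaussian vector Z the same formula holds
with the identity matrix, so the size of A - 1 should control the distance from F to Z.

This is made precise by an interpolation (`IsSteinKernel.abs_integral_sub_le_of_contDiff`). With Z
independent of F, put Y_θ = sin θ F + cos θ Z for 0 ≤ θ ≤ π/2. Integrating by parts once in F and
once in Z turns the derivative of 𝔼 h(Y_θ) into sin θ 𝔼⟨∇h(Y_θ), (A - 1)Z⟩. If h is 1-Lipschitz this
is at most sin θ 𝔼‖A - 1‖ in absolute value, with the Hilbert–Schmidt norm, because 𝔼|MZ| ≤ ‖M‖. As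
sin has integral 1 over [0, π/2], it follows that d_W(F, Z) ≤ 𝔼‖A - 1‖. Mollification reduces the
general Lipschitz test function to a smooth one.

It remains to average over the coefficients. By Cauchy–Schwarz on the torus and then on the
coefficient space, it suffices to bound the mean square of each entry of A - 1
(`integral_integral_sq_torusKernel_sub_one_le`). These entries are quadratic in the coefficients,
with weights ⟨v, w⟩_B sin(2π⟨Bv, x⟩) sin(2π⟨Bw, x⟩) up to a factor, so their mean squares need only
the second and fourth moments of the uniform distribution on a sphere and the integrals of sin²
sin². On the diagonal the leading terms of 𝔼A_{rr}² and 𝔼A_{rr} cancel against the 1, and the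
remainder has a favourable sign. -/

/-! ### Smooth approximation of Lipschitz functions -/

section Mollification

open scoped Convolution

variable {E F F' G : Type*} [NormedAddCommGroup E] [MeasurableSpace E] [BorelSpace E]
  [NormedAddCommGroup F] [NormedSpace ℝ F] [NormedAddCommGroup F'] [NormedSpace ℝ F']
  [NormedAddCommGroup G] [NormedSpace ℝ G]

theorem norm_convolution_sub_le_of_lipschitzWith (μ : Measure E) [IsFiniteMeasureOnCompacts μ]
    (L : F →L[ℝ] F' →L[ℝ] G) {f : E → F} (hf : Continuous f)
    (hfc : HasCompactSupport f) {g : E → F'} (hg : LipschitzWith 1 g) (x y : E) :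
    ‖(f ⋆[L, μ] g) x - (f ⋆[L, μ] g) y‖ ≤ (‖L‖ * ∫ t, ‖f t‖ ∂μ) * ‖x - y‖ := by
  have hint : ∀ z, Integrable (fun t => L (f t) (g (z - t))) μ := fun z =>
    Continuous.integrable_of_hasCompactSupport
      ((L.continuous.comp hf).clm_apply (hg.continuous.comp (continuous_const.sub continuous_id)))
      (hfc.mono fun t ht => by
        rw [Function.mem_support] at ht ⊢
        contrapose! ht
        simp [ht])
  have hfi : Integrable f μ := hf.integrable_of_hasCompactSupport hfc
  rw [convolution_def, convolution_def, ← integral_sub (hint x) (hint y)]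
  calc ‖∫ t, L (f t) (g (x - t)) - L (f t) (g (y - t)) ∂μ‖
      ≤ ∫ t, ‖L‖ * ‖f t‖ * ‖x - y‖ ∂μ := by
        refine norm_integral_le_of_norm_le ((hfi.norm.const_mul _).mul_const _)
          (Filter.Eventually.of_forall fun t => ?_)
        rw [← map_sub]
        refine (L.le_opNorm₂ _ _).trans ?_
        gcongr
        have := hg.dist_le_mul (x - t) (y - t)
        simpa [dist_eq_norm] using this
    _ = _ := by rw [integral_mul_const, integral_const_mul]

theorem exists_lipschitzWith_convolution (μ : Measure E) [IsFiniteMeasureOnCompacts μ]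
    (L : F →L[ℝ] F' →L[ℝ] G) {f : E → F} (hf : Continuous f)
    (hfc : HasCompactSupport f) {g : E → F'} (hg : LipschitzWith 1 g) :
    ∃ C : NNReal, LipschitzWith C (f ⋆[L, μ] g) := by
  refine ⟨⟨‖L‖ * ∫ t, ‖f t‖ ∂μ, mul_nonneg L.opNorm_nonneg (integral_nonneg fun _ =>
    norm_nonneg _)⟩, LipschitzWith.of_dist_le_mul fun x y => ?_⟩
  rw [dist_eq_norm, dist_eq_norm]
  exact norm_convolution_sub_le_of_lipschitzWith μ L hf hfc hg x y

/-- Convolve with a normalized bump supported in the ball of radius ε: averaging preserves the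
Lipschitz constant, and moves g by at most ε. The second derivative is bounded because D(φ ⋆ g) = Dφ
⋆ g is again a convolution with a Lipschitz function, hence Lipschitz. -/
theorem exists_contDiff_lipschitzWith_approx [NormedSpace ℝ E] [FiniteDimensional ℝ E] {g : E → ℝ} (hg : LipschitzWith 1 g) {ε : ℝ}
    (hε : 0 < ε) : ∃ h : E → ℝ, ContDiff ℝ 2 h ∧ LipschitzWith 1 h ∧
      (∃ C, ∀ x, ‖fderiv ℝ (fderiv ℝ h) x‖ ≤ C) ∧ ∀ x, |h x - g x| ≤ ε := by
  let μ : Measure E := Measure.addHaar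
  let φ : ContDiffBump (0 : E) := ⟨ε / 2, ε, by positivity, by linarith⟩
  have hc : HasCompactSupport (φ.normed μ) := φ.hasCompactSupport_normed
  have hsm : ContDiff ℝ ((2 : ℕ∞) : WithTop ℕ∞) (φ.normed μ) := φ.contDiff_normed
  have hgl : LocallyIntegrable g μ := hg.continuous.locallyIntegrable
  set L : ℝ →L[ℝ] ℝ →L[ℝ] ℝ := ContinuousLinearMap.lsmul ℝ ℝ
  refine ⟨φ.normed μ ⋆[L, μ] g, hc.contDiff_convolution_left L hsm hgl, ?_, ?_, ?_⟩
  · refine LipschitzWith.of_dist_le_mul fun x y => ?_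
    rw [dist_eq_norm, dist_eq_norm]
    refine (norm_convolution_sub_le_of_lipschitzWith μ L hsm.continuous hc hg x y).trans ?_
    have h1 : ∫ t, ‖φ.normed μ t‖ ∂μ = 1 := by
      rw [← φ.integral_normed (μ := μ)]
      exact integral_congr_ae (Filter.Eventually.of_forall fun t =>
        Real.norm_of_nonneg (φ.nonneg_normed t))
    rw [h1]
    gcongr
    simpa only [mul_one, NNReal.coe_one] using
      ContinuousLinearMap.opNorm_lsmul_le (𝕜 := ℝ) (R := ℝ) (E := ℝ)
  · have hfd : fderiv ℝ (φ.normed μ ⋆[L, μ] g) =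
        fderiv ℝ (φ.normed μ) ⋆[L.precompL E, μ] g := funext fun x =>
      (hc.hasFDerivAt_convolution_left L (hsm.of_le (by norm_num)) hgl x).fderiv
    rw [hfd]
    obtain ⟨C, hC⟩ := exists_lipschitzWith_convolution μ (L.precompL E)
      (hsm.continuous_fderiv (by norm_num)) (hc.fderiv ℝ) hg
    exact ⟨C, fun x => norm_fderiv_le_of_lipschitz ℝ hC⟩
  · intro x
    rw [← Real.dist_eq]
    refine φ.dist_normed_convolution_le hg.continuous.aestronglyMeasurable fun y hy => ?_
    have := hg.dist_le_mul y x
    simp only [NNReal.coe_one, one_mul] at this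
    exact this.trans (Metric.mem_ball.1 hy).le

end Mollification

/-! ### Gaussian integration by parts -/

section GaussianIntegrationByParts

theorem integrable_gaussianReal_iff {f : ℝ → ℝ} :
    Integrable f (gaussianReal 0 1) ↔ Integrable (fun x => gaussianPDFReal 0 1 x * f x) := by
  rw [gaussianReal_of_var_ne_zero _ one_ne_zero, gaussianPDF_def,
    integrable_withDensity_iff_integrable_smul₀' (by fun_prop) (by simp)]
  simp [ENNReal.toReal_ofReal, gaussianPDFReal_nonneg]

theorem hasDerivAt_gaussianPDFReal_zero_one (x : ℝ) :
    HasDerivAt (gaussianPDFReal 0 1) (-(x * gaussianPDFReal 0 1 x)) x := by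
  have h : HasDerivAt (fun y : ℝ => -(y - 0) ^ 2 / (2 * ((1 : NNReal) : ℝ))) (-x) x := by
    have := (((hasDerivAt_id x).sub_const 0).pow 2).neg.div_const (2 * ((1 : NNReal) : ℝ))
    refine this.congr_deriv ?_
    simp
    ring
  rw [gaussianPDFReal_def]
  refine (h.exp.const_mul _).congr_deriv ?_
  ring

/-- The Gaussian density p satisfies p' = -x p, so this is integration by parts on the line. A
bounded derivative forces at most linear growth of φ, which makes all the products integrable. -/
theorem integral_id_mul_gaussianReal {φ φ' : ℝ → ℝ} (hφ : ∀ x, HasDerivAt φ (φ' x) x) {C : ℝ}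
    (hC : ∀ x, |φ' x| ≤ C) :
    ∫ x, x * φ x ∂(gaussianReal 0 1) = ∫ x, φ' x ∂(gaussianReal 0 1) := by
  have hdiff : Differentiable ℝ φ := fun x => (hφ x).differentiableAt
  have hφ' : φ' = deriv φ := funext fun x => (hφ x).deriv.symm
  have hb : ∀ x, |φ x| ≤ |φ 0| + C * |x| := by
    intro x
    have := Convex.norm_image_sub_le_of_norm_hasDerivWithin_le (f := φ) (s := Set.univ)
      (fun y _ => (hφ y).hasDerivWithinAt) (fun y _ => hC y) convex_univ
      (Set.mem_univ 0) (Set.mem_univ x)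
    simp only [Real.norm_eq_abs, sub_zero] at this
    have := abs_sub_abs_le_abs_sub (φ x) (φ 0)
    linarith
  have h1 : Integrable (fun x : ℝ => |x|) (gaussianReal 0 1) :=
    (IsGaussian.integrable_id (μ := gaussianReal 0 1)).norm
  have h2 : Integrable (fun x : ℝ => x ^ 2) (gaussianReal 0 1) :=
    (IsGaussian.memLp_two_id (μ := gaussianReal 0 1)).integrable_sq
  have i0 : Integrable φ (gaussianReal 0 1) :=
    ((integrable_const _).add (h1.const_mul C)).mono' hdiff.continuous.aestronglyMeasurable
      (Filter.Eventually.of_forall hb)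
  have i1 : Integrable (fun x => x * φ x) (gaussianReal 0 1) := by
    refine ((h1.const_mul |φ 0|).add (h2.const_mul C)).mono'
      (by have := hdiff.continuous; fun_prop) (Filter.Eventually.of_forall fun x => ?_)
    rw [norm_mul, Real.norm_eq_abs, Real.norm_eq_abs]
    calc |x| * |φ x| ≤ |x| * (|φ 0| + C * |x|) := by gcongr; exact hb x
      _ = |φ 0| * |x| + C * x ^ 2 := by rw [← sq_abs x]; ring
  have i2 : Integrable φ' (gaussianReal 0 1) :=
    (integrable_const C).mono' (hφ' ▸ (measurable_deriv φ).aestronglyMeasurable)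
      (Filter.Eventually.of_forall hC)
  rw [integrable_gaussianReal_iff] at i0 i1 i2
  rw [integral_gaussianReal_eq_integral_smul one_ne_zero,
    integral_gaussianReal_eq_integral_smul one_ne_zero]
  simp only [smul_eq_mul]
  have key := integral_mul_deriv_eq_deriv_mul_of_integrable (u := gaussianPDFReal 0 1)
    (u' := fun x => -(x * gaussianPDFReal 0 1 x)) (v := φ) (v' := φ')
    (fun x _ => hasDerivAt_gaussianPDFReal_zero_one x) (fun x _ => hφ x) i2
    (i1.neg.congr (Filter.Eventually.of_forall fun x => by simp; ring)) i0
  rw [key, ← integral_neg]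
  congr 1 with x
  ring

/-- Fubini isolates the coordinate s; with the others frozen, the one-dimensional formula applies.
Only the derivative along that axis enters. -/
theorem integral_coord_mul_pi_gaussianReal {m : ℕ} (s : Fin m) {φ φ' : (Fin m → ℝ) → ℝ}
    (hφ : ∀ z, HasLineDerivAt ℝ φ (φ' z) z (Pi.single s 1)) {C : ℝ} (hC : ∀ z, |φ' z| ≤ C)
    (hm : AEStronglyMeasurable φ' (Measure.pi fun _ => gaussianReal 0 1))
    (hi : Integrable (fun z => z s * φ z) (Measure.pi fun _ => gaussianReal 0 1)) :
    ∫ z, z s * φ z ∂(Measure.pi fun _ => gaussianReal 0 1) =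
      ∫ z, φ' z ∂(Measure.pi fun _ => gaussianReal 0 1) := by
  obtain _ | m := m
  · exact s.elim0
  have mp := (measurePreserving_piFinSuccAbove (fun _ : Fin (m + 1) => gaussianReal 0 1) s).symm
  have hi' : Integrable φ' (Measure.pi fun _ => gaussianReal 0 1) :=
    (integrable_const C).mono' hm (Filter.Eventually.of_forall hC)
  rw [← mp.integral_comp', ← mp.integral_comp']
  rw [← mp.integrable_comp_emb (MeasurableEquiv.measurableEmbedding _)] at hi hi'
  refine (integral_prod_symm _ hi).trans (Eq.trans ?_ (integral_prod_symm _ hi').symm)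
  congr 1 with y
  have e : ∀ t : ℝ, (MeasurableEquiv.piFinSuccAbove (fun _ : Fin (m + 1) => ℝ) s).symm (t, y) =
      s.insertNth t y := fun t => rfl
  simp only [Function.comp, e, Fin.insertNth_apply_same]
  refine integral_id_mul_gaussianReal (φ := fun t => φ (s.insertNth t y)) (fun t => ?_)
    (fun t => hC _)
  have h := hφ (s.insertNth t y)
  rw [HasLineDerivAt] at h
  have h2 := HasDerivAt.scomp_of_eq t (g₁ := fun u : ℝ => φ (s.insertNth t y + u • Pi.single s 1))
    (h := fun u => u - t) h ((hasDerivAt_id t).sub_const t) (by simp)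
  simp only [one_smul] at h2
  refine h2.congr_of_eventuallyEq (Filter.Eventually.of_forall fun u => ?_)
  simp only [Function.comp]
  congr 1
  ext j
  refine s.succAboveCases ?_ (fun j => ?_) j
  · simp
  · simp

theorem integral_coord_mul_stdGaussian {m : ℕ} (s : Fin m) {φ : EuclideanSpace ℝ (Fin m) → ℝ}
    (hφ : ContDiff ℝ 1 φ) {C : ℝ} (hC : ∀ z, ‖fderiv ℝ φ z‖ ≤ C) :
    ∫ z, z s * φ z ∂(stdGaussian (EuclideanSpace ℝ (Fin m))) =
      ∫ z, fderiv ℝ φ z (EuclideanSpace.single s 1) ∂(stdGaussian (EuclideanSpace ℝ (Fin m))) := by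
  have hd : Differentiable ℝ φ := hφ.differentiable one_ne_zero
  have hdc : Continuous (fun z => fderiv ℝ φ z (EuclideanSpace.single s 1)) :=
    (hφ.continuous_fderiv one_ne_zero).clm_apply continuous_const
  have hb : ∀ z, |φ z| ≤ |φ 0| + C * ‖z‖ := by
    intro z
    have := Convex.norm_image_sub_le_of_norm_fderiv_le (f := φ) (s := Set.univ)
      (fun y _ => hd y) (fun y _ => hC y) convex_univ (Set.mem_univ 0) (Set.mem_univ z)
    simp only [Real.norm_eq_abs, sub_zero] at this
    have := abs_sub_abs_le_abs_sub (φ z) (φ 0)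
    linarith
  have hi : Integrable (fun z => z s * φ z) (stdGaussian (EuclideanSpace ℝ (Fin m))) := by
    have h1 : Integrable (fun z => ‖z‖) (stdGaussian (EuclideanSpace ℝ (Fin m))) :=
      (IsGaussian.integrable_id (μ := stdGaussian (EuclideanSpace ℝ (Fin m)))).norm
    have h2 : Integrable (fun z => ‖z‖ ^ 2) (stdGaussian (EuclideanSpace ℝ (Fin m))) :=
      (IsGaussian.memLp_two_id (μ := stdGaussian (EuclideanSpace ℝ (Fin m)))).norm.integrable_sq
    refine ((h1.const_mul |φ 0|).add (h2.const_mul C)).mono'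
      (by have := hd.continuous; fun_prop) (Filter.Eventually.of_forall fun z => ?_)
    rw [norm_mul]
    calc ‖z s‖ * ‖φ z‖ ≤ ‖z‖ * (|φ 0| + C * ‖z‖) := by
          gcongr
          · exact PiLp.norm_apply_le z s
          · exact hb z
      _ = |φ 0| * ‖z‖ + C * ‖z‖ ^ 2 := by ring
  have hem : MeasurableEmbedding (WithLp.toLp 2 : (Fin m → ℝ) → EuclideanSpace ℝ (Fin m)) :=
    (MeasurableEquiv.toLp 2 (Fin m → ℝ)).measurableEmbedding
  rw [← map_pi_eq_stdGaussian, hem.integrable_map_iff] at hi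
  rw [← map_pi_eq_stdGaussian, hem.integral_map, hem.integral_map]
  have hcont : Continuous (WithLp.toLp 2 : (Fin m → ℝ) → EuclideanSpace ℝ (Fin m)) :=
    PiLp.continuous_toLp 2 _
  refine integral_coord_mul_pi_gaussianReal s (φ := fun z => φ (WithLp.toLp 2 z))
    (fun z => ?_) (C := C) (fun z => ?_)
    (hdc.comp hcont).aestronglyMeasurable hi
  · have := (hd (WithLp.toLp 2 z)).hasFDerivAt.hasLineDerivAt (EuclideanSpace.single s 1)
    rw [HasLineDerivAt] at this ⊢
    refine this.congr_of_eventuallyEq (Filter.Eventually.of_forall fun t => ?_)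
    simp
  · refine ((fderiv ℝ φ _).le_opNorm _).trans ?_
    simpa using hC (WithLp.toLp 2 z)

end GaussianIntegrationByParts

/-! ### Stein kernels and the Wasserstein bound -/

section SteinKernel

variable {T : Type*} [MeasurableSpace T] {k : ℕ}

/-- `A` is a bounded Stein kernel for the bounded random vector `F`: the integration by parts
formula `𝔼[F_r φ(F)] = 𝔼[∑ s, A_{rs} ∂_s φ(F)]` holds for `C¹` functions `φ` with bounded
derivative. -/
structure IsSteinKernel (ν : Measure T) (F : T → EuclideanSpace ℝ (Fin k))
    (A : T → Matrix (Fin k) (Fin k) ℝ) : Prop where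
  measurable_fun : Measurable F
  measurable_kernel : ∀ r s, Measurable fun x => A x r s
  bounded_fun : ∃ K, ∀ x, ‖F x‖ ≤ K
  bounded_kernel : ∃ K, ∀ x r s, |A x r s| ≤ K
  integral_eq : ∀ (r : Fin k) (φ : EuclideanSpace ℝ (Fin k) → ℝ), ContDiff ℝ 1 φ →
    (∃ C, ∀ z, ‖fderiv ℝ φ z‖ ≤ C) →
    ∫ x, F x r * φ (F x) ∂ν =
      ∫ x, ∑ s, A x r s * fderiv ℝ φ (F x) (EuclideanSpace.single s 1) ∂ν

/-- The Hilbert–Schmidt norm of `A - 1`. -/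
noncomputable def steinDiscrepancy (A : Matrix (Fin k) (Fin k) ℝ) : ℝ :=
  Real.sqrt (∑ r, ∑ s, (A - 1) r s ^ 2)

theorem integrable_norm_stdGaussian :
    Integrable (fun z => ‖z‖) (stdGaussian (EuclideanSpace ℝ (Fin k))) :=
  (IsGaussian.integrable_id (μ := stdGaussian (EuclideanSpace ℝ (Fin k)))).norm

theorem integrable_sq_norm_stdGaussian :
    Integrable (fun z => ‖z‖ ^ 2) (stdGaussian (EuclideanSpace ℝ (Fin k))) :=
  (IsGaussian.memLp_two_id (μ := stdGaussian (EuclideanSpace ℝ (Fin k)))).norm.integrable_sq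

theorem integrable_prod_stdGaussian_of_le {ν : Measure T} [IsProbabilityMeasure ν]
    {f : T × EuclideanSpace ℝ (Fin k) → ℝ} (hf : Measurable f) (a b : ℝ)
    (h : ∀ p, |f p| ≤ a + b * ‖p.2‖) :
    Integrable f (ν.prod (stdGaussian (EuclideanSpace ℝ (Fin k)))) :=
  ((integrable_const a).add ((integrable_norm_stdGaussian.comp_snd ν).const_mul b)).mono'
    hf.aestronglyMeasurable (Filter.Eventually.of_forall h)

/-- Gaussian integration by parts for the linear function φ(z) = z_t. -/
theorem integral_coord_mul_coord_stdGaussian (s t : Fin k) :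
    ∫ z, z s * z t ∂(stdGaussian (EuclideanSpace ℝ (Fin k))) = if s = t then 1 else 0 := by
  let L : EuclideanSpace ℝ (Fin k) →L[ℝ] ℝ := EuclideanSpace.proj t
  have := integral_coord_mul_stdGaussian s (φ := L) L.contDiff (C := ‖L‖)
    (fun z => by rw [L.fderiv])
  simp only [L.fderiv] at this
  simpa [L, eq_comm] using this

theorem sq_integral_le_integral_sq {μ : Measure T} [IsProbabilityMeasure μ] {f : T → ℝ}
    (hf : MemLp f 2 μ) : (∫ x, f x ∂μ) ^ 2 ≤ ∫ x, f x ^ 2 ∂μ := by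
  have h := variance_eq_sub hf
  have := variance_nonneg f μ
  simp only [Pi.pow_apply] at h
  linarith

/-- Cauchy–Schwarz bounds 𝔼|MZ| by the root of 𝔼|MZ|², which is the squared Hilbert–Schmidt norm
since the coordinates of Z are orthonormal. -/
theorem integral_norm_mulVec_stdGaussian_le (M : Matrix (Fin k) (Fin k) ℝ) :
    ∫ z, ‖(WithLp.toLp 2 (M *ᵥ z) : EuclideanSpace ℝ (Fin k))‖
      ∂(stdGaussian (EuclideanSpace ℝ (Fin k))) ≤ Real.sqrt (∑ r, ∑ s, M r s ^ 2) := by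
  set γ := stdGaussian (EuclideanSpace ℝ (Fin k))
  let L : EuclideanSpace ℝ (Fin k) →L[ℝ] EuclideanSpace ℝ (Fin k) :=
    Matrix.toEuclideanCLM (𝕜 := ℝ) M
  have hL : ∀ z : EuclideanSpace ℝ (Fin k),
      (WithLp.toLp 2 (M *ᵥ z) : EuclideanSpace ℝ (Fin k)) = L z := fun z => rfl
  have hmem : MemLp (fun z : EuclideanSpace ℝ (Fin k) =>
      ‖(WithLp.toLp 2 (M *ᵥ z) : EuclideanSpace ℝ (Fin k))‖) 2 γ := by
    simp only [hL]
    exact (L.comp_memLp' (IsGaussian.memLp_two_id (μ := γ))).norm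
  refine Real.le_sqrt_of_sq_le ((sq_integral_le_integral_sq hmem).trans_eq ?_)
  have hint : ∀ s t : Fin k, Integrable (fun z : EuclideanSpace ℝ (Fin k) => z s * z t) γ := by
    intro s t
    refine integrable_sq_norm_stdGaussian.mono'
      (by fun_prop) (Filter.Eventually.of_forall fun z => ?_)
    rw [norm_mul, sq]
    gcongr <;> exact PiLp.norm_apply_le z _
  have e : ∀ z : EuclideanSpace ℝ (Fin k),
      ‖(WithLp.toLp 2 (M *ᵥ z) : EuclideanSpace ℝ (Fin k))‖ ^ 2 =
        ∑ r, ∑ s, ∑ t, M r s * M r t * (z s * z t) := fun z => by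
    rw [EuclideanSpace.real_norm_sq_eq]
    refine Finset.sum_congr rfl fun r _ => ?_
    simp only [Matrix.mulVec, dotProduct, sq, Finset.sum_mul_sum]
    refine Finset.sum_congr rfl fun s _ => Finset.sum_congr rfl fun t _ => ?_
    ring
  simp only [e]
  rw [integral_finsetSum _ fun r _ => integrable_finsetSum _ fun s _ =>
    integrable_finsetSum _ fun t _ => (hint s t).const_mul _]
  refine Finset.sum_congr rfl fun r _ => ?_
  rw [integral_finsetSum _ fun s _ => integrable_finsetSum _ fun t _ => (hint s t).const_mul _]
  refine Finset.sum_congr rfl fun s _ => ?_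
  rw [integral_finsetSum _ fun t _ => (hint s t).const_mul _]
  simp only [integral_const_mul, γ, integral_coord_mul_coord_stdGaussian]
  simp [sq]

theorem fderiv_comp_smul_add {φ : EuclideanSpace ℝ (Fin k) → ℝ} (hφ : Differentiable ℝ φ)
    (a : ℝ) (b w v : EuclideanSpace ℝ (Fin k)) :
    fderiv ℝ (fun y => φ (a • y + b)) w v = a * fderiv ℝ φ (a • w + b) v := by
  have h1 : HasFDerivAt (fun y : EuclideanSpace ℝ (Fin k) => a • y + b)
      (a • ContinuousLinearMap.id ℝ _) w := ((hasFDerivAt_id w).const_smul a).add_const b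
  have h2 : HasFDerivAt (fun y => φ (a • y + b)) _ w := (hφ (a • w + b)).hasFDerivAt.comp w h1
  rw [h2.fderiv]
  simp

/-- Both sides equal ab 𝔼[∑_s A_{rs} ∂_s φ(aF + bZ)]: on the left apply the kernel identity to F
with Z frozen, on the right Gaussian integration by parts to Z with F frozen. The factors a and b
stay on the two sides so that no division is needed when one vanishes. -/
theorem IsSteinKernel.integral_coord_mul_comp {ν : Measure T} [IsProbabilityMeasure ν]
    {F : T → EuclideanSpace ℝ (Fin k)} {A : T → Matrix (Fin k) (Fin k) ℝ}
    (hA : IsSteinKernel ν F A) (r : Fin k) {φ : EuclideanSpace ℝ (Fin k) → ℝ}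
    (hφ : ContDiff ℝ 1 φ) {K C : ℝ} (hK : ∀ z, |φ z| ≤ K) (hC : ∀ z, ‖fderiv ℝ φ z‖ ≤ C)
    (a b : ℝ) :
    b * ∫ p, F p.1 r * φ (a • F p.1 + b • p.2) ∂(ν.prod (stdGaussian (EuclideanSpace ℝ (Fin k)))) =
    a * ∫ p, (∑ s, A p.1 r s * p.2 s) * φ (a • F p.1 + b • p.2)
      ∂(ν.prod (stdGaussian (EuclideanSpace ℝ (Fin k)))) := by
  set γ := stdGaussian (EuclideanSpace ℝ (Fin k))
  obtain ⟨KF, hKF⟩ := hA.bounded_fun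
  obtain ⟨KA, hKA⟩ := hA.bounded_kernel
  have hFm := hA.measurable_fun
  have hAm := hA.measurable_kernel
  have hφm : Measurable φ := hφ.continuous.measurable
  have hd : Differentiable ℝ φ := hφ.differentiable one_ne_zero
  have hdm : ∀ s : Fin k, Measurable fun z => fderiv ℝ φ z (EuclideanSpace.single s 1) :=
    fun s => ((hφ.continuous_fderiv one_ne_zero).clm_apply continuous_const).measurable
  have hds : ∀ z (s : Fin k), |fderiv ℝ φ z (EuclideanSpace.single s 1)| ≤ C := fun z s => by
    refine ((fderiv ℝ φ z).le_opNorm _).trans ?_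
    simpa using hC z
  have hC0 : 0 ≤ C := (norm_nonneg _).trans (hC 0)
  have hK0 : 0 ≤ K := (abs_nonneg _).trans (hK 0)
  have hKF' : ∀ x, |F x r| ≤ KF := fun x => (PiLp.norm_apply_le (F x) r).trans (hKF x)
  have hKF0 : ∀ x : T, 0 ≤ KF := fun x => (norm_nonneg _).trans (hKF x)
  have hKA0 : ∀ x : T, 0 ≤ KA := fun x => (abs_nonneg _).trans (hKA x r r)
  have i1 : Integrable (fun p : T × EuclideanSpace ℝ (Fin k) =>
      F p.1 r * φ (a • F p.1 + b • p.2)) (ν.prod γ) := by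
    refine integrable_prod_stdGaussian_of_le (by fun_prop) (KF * K) 0 fun p => ?_
    rw [abs_mul, zero_mul, add_zero]
    exact mul_le_mul (hKF' _) (hK _) (abs_nonneg _) (hKF0 p.1)
  have i2 : ∀ s : Fin k, Integrable (fun p : T × EuclideanSpace ℝ (Fin k) =>
      A p.1 r s * fderiv ℝ φ (a • F p.1 + b • p.2) (EuclideanSpace.single s 1)) (ν.prod γ) := by
    intro s
    have hdm := hdm s
    have hAm := hAm r s
    refine integrable_prod_stdGaussian_of_le (Measurable.mul (hAm.comp measurable_fst)
      (hdm.comp (by fun_prop))) (KA * C) 0 fun p => ?_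
    rw [abs_mul, zero_mul, add_zero]
    exact mul_le_mul (hKA _ _ _) (hds _ _) (abs_nonneg _) (hKA0 p.1)
  have i3 : ∀ s : Fin k, Integrable (fun p : T × EuclideanSpace ℝ (Fin k) =>
      A p.1 r s * (p.2 s * φ (a • F p.1 + b • p.2))) (ν.prod γ) := by
    intro s
    have hAm := hAm r s
    refine integrable_prod_stdGaussian_of_le (Measurable.mul (hAm.comp measurable_fst)
      (by fun_prop)) 0 (KA * K) fun p => ?_
    rw [abs_mul, abs_mul, zero_add]
    calc |A p.1 r s| * (|p.2 s| * |φ (a • F p.1 + b • p.2)|) ≤ KA * (‖p.2‖ * K) := by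
          gcongr
          · exact hKA0 p.1
          · exact hKA _ _ _
          · exact PiLp.norm_apply_le p.2 s
          · exact hK _
      _ = _ := by ring
  have e1 : ∫ p, F p.1 r * φ (a • F p.1 + b • p.2) ∂(ν.prod γ) =
      a * ∑ s, ∫ p, A p.1 r s * fderiv ℝ φ (a • F p.1 + b • p.2) (EuclideanSpace.single s 1)
        ∂(ν.prod γ) := by
    rw [← integral_finsetSum _ fun s _ => i2 s, ← integral_const_mul, integral_prod_symm _ i1,
      integral_prod_symm _ ((integrable_finsetSum _ fun s _ => i2 s).const_mul a)]
    congr 1 with z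
    have hcd : ContDiff ℝ 1 (fun y => φ (a • y + b • z)) :=
      hφ.comp ((contDiff_id.const_smul a).add contDiff_const)
    have := hA.integral_eq r (fun y => φ (a • y + b • z)) hcd ⟨|a| * C, fun w => ?_⟩
    · rw [this]
      congr 1 with x
      simp only [fderiv_comp_smul_add hd, Finset.mul_sum]
      exact Finset.sum_congr rfl fun s _ => by ring
    · refine ContinuousLinearMap.opNorm_le_bound _ (by positivity) fun v => ?_
      rw [fderiv_comp_smul_add hd, norm_mul, mul_assoc]
      gcongr
      · exact le_rfl
      · exact (fderiv ℝ φ _).le_of_opNorm_le (hC _) v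
  have e2 : ∀ s : Fin k, ∫ p, A p.1 r s * (p.2 s * φ (a • F p.1 + b • p.2)) ∂(ν.prod γ) =
      b * ∫ p, A p.1 r s * fderiv ℝ φ (a • F p.1 + b • p.2) (EuclideanSpace.single s 1)
        ∂(ν.prod γ) := by
    intro s
    rw [← integral_const_mul, integral_prod _ (i3 s), integral_prod _ ((i2 s).const_mul b)]
    congr 1 with x
    have hcd : ContDiff ℝ 1 (fun y => φ (b • y + a • F x)) :=
      hφ.comp ((contDiff_id.const_smul b).add contDiff_const)
    have := integral_coord_mul_stdGaussian s hcd (C := |b| * C) fun w => ?_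
    · simp only [fderiv_comp_smul_add hd] at this
      simp only [add_comm (_ • _) (a • F x)] at this
      simp only [integral_const_mul] at this ⊢
      rw [this]
      ring
    · refine ContinuousLinearMap.opNorm_le_bound _ (by positivity) fun v => ?_
      rw [fderiv_comp_smul_add hd, norm_mul, mul_assoc]
      gcongr
      · exact le_rfl
      · exact (fderiv ℝ φ _).le_of_opNorm_le (hC _) v
  have e3 : ∀ p : T × EuclideanSpace ℝ (Fin k),
      (∑ s, A p.1 r s * p.2 s) * φ (a • F p.1 + b • p.2) =
      ∑ s, A p.1 r s * (p.2 s * φ (a • F p.1 + b • p.2)) := fun p => by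
    rw [Finset.sum_mul]
    exact Finset.sum_congr rfl fun s _ => by ring
  simp only [e3]
  rw [integral_finsetSum _ fun s _ => i3 s, e1]
  simp only [e2, Finset.mul_sum]
  exact Finset.sum_congr rfl fun s _ => by ring

theorem memLp_steinDiscrepancy {ν : Measure T} [IsProbabilityMeasure ν]
    {F : T → EuclideanSpace ℝ (Fin k)} {A : T → Matrix (Fin k) (Fin k) ℝ}
    (hA : IsSteinKernel ν F A) : MemLp (fun x => steinDiscrepancy (A x)) 2 ν := by
  obtain ⟨K, hK⟩ := hA.bounded_kernel
  have hAm := hA.measurable_kernel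
  have hm : Measurable fun x => steinDiscrepancy (A x) :=
    (Finset.measurable_sum _ fun r _ => Finset.measurable_sum _ fun s _ =>
      ((hAm r s).sub_const _).pow_const 2).sqrt
  refine MemLp.of_bound hm.aestronglyMeasurable
    (Real.sqrt (∑ _r : Fin k, ∑ _s : Fin k, (K + 1) ^ 2)) (Filter.Eventually.of_forall fun x => ?_)
  rw [steinDiscrepancy, Real.norm_of_nonneg (Real.sqrt_nonneg _)]
  refine Real.sqrt_le_sqrt (Finset.sum_le_sum fun r _ => Finset.sum_le_sum fun s _ => ?_)
  rw [sq_le_sq]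
  have h1 : |(1 : Matrix (Fin k) (Fin k) ℝ) r s| ≤ 1 := by
    rw [Matrix.one_apply]
    split_ifs <;> simp
  have h2 : 0 ≤ K := (abs_nonneg _).trans (hK x r s)
  rw [abs_of_nonneg (by linarith : 0 ≤ K + 1), Matrix.sub_apply]
  exact (abs_sub _ _).trans (add_le_add (hK x r s) h1)

/-- The function ψ(θ) = 𝔼 h(sin θ F + cos θ Z) joins 𝔼 h(Z) at θ = 0 to 𝔼 h(F) at θ = π/2. Its
derivative is cos θ 𝔼⟨F, ∇h⟩ - sin θ 𝔼⟨Z, ∇h⟩, and trading F for AZ by the preceding identity leaves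
sin θ 𝔼⟨(A - 1)Z, ∇h⟩. -/
theorem IsSteinKernel.abs_integral_sub_le_of_contDiff {ν : Measure T} [IsProbabilityMeasure ν]
    {F : T → EuclideanSpace ℝ (Fin k)} {A : T → Matrix (Fin k) (Fin k) ℝ}
    (hA : IsSteinKernel ν F A) {h : EuclideanSpace ℝ (Fin k) → ℝ} (hh : ContDiff ℝ 2 h)
    (hl : LipschitzWith 1 h) {C : ℝ} (hC : ∀ z, ‖fderiv ℝ (fderiv ℝ h) z‖ ≤ C) :
    |(∫ x, h (F x) ∂ν) - ∫ z, h z ∂(stdGaussian (EuclideanSpace ℝ (Fin k)))| ≤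
      ∫ x, steinDiscrepancy (A x) ∂ν := by
  set γ := stdGaussian (EuclideanSpace ℝ (Fin k))
  set D := ∫ x, steinDiscrepancy (A x) ∂ν
  have hFm := hA.measurable_fun
  have hAm := hA.measurable_kernel
  obtain ⟨KF, hKF⟩ := hA.bounded_fun
  obtain ⟨KA, hKA⟩ := hA.bounded_kernel
  have hd : Differentiable ℝ h := hh.differentiable two_ne_zero
  have hd1 : ∀ z, ‖fderiv ℝ h z‖ ≤ 1 := fun z => by
    simpa using norm_fderiv_le_of_lipschitz ℝ hl (x₀ := z)
  have hcf : ContDiff ℝ 1 (fderiv ℝ h) := hh.fderiv_right (by norm_num)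
  have hb : ∀ z, |h z| ≤ |h 0| + ‖z‖ := fun z => by
    have := hl.dist_le_mul z 0
    rw [Real.dist_eq, dist_zero_right, NNReal.coe_one, one_mul] at this
    linarith [abs_sub_abs_le_abs_sub (h z) (h 0)]
  let Y : ℝ → T × EuclideanSpace ℝ (Fin k) → EuclideanSpace ℝ (Fin k) :=
    fun θ p => Real.sin θ • F p.1 + Real.cos θ • p.2
  have hYm : ∀ θ, Measurable (Y θ) := fun θ => by fun_prop
  have hYn : ∀ θ p, ‖Y θ p‖ ≤ KF + ‖p.2‖ := fun θ p => by
    refine (norm_add_le _ _).trans ?_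
    rw [norm_smul, norm_smul]
    have h1 := Real.abs_sin_le_one θ
    have h2 := Real.abs_cos_le_one θ
    refine add_le_add ((mul_le_of_le_one_left (norm_nonneg _) h1).trans (hKF _))
      (mul_le_of_le_one_left (norm_nonneg _) h2)
  let Y' : ℝ → T × EuclideanSpace ℝ (Fin k) → EuclideanSpace ℝ (Fin k) :=
    fun θ p => Real.cos θ • F p.1 - Real.sin θ • p.2
  have hYn' : ∀ θ p, ‖Y' θ p‖ ≤ KF + ‖p.2‖ := fun θ p => by
    refine (norm_sub_le _ _).trans ?_
    rw [norm_smul, norm_smul]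
    have h1 := Real.abs_sin_le_one θ
    have h2 := Real.abs_cos_le_one θ
    refine add_le_add ((mul_le_of_le_one_left (norm_nonneg _) h2).trans (hKF _))
      (mul_le_of_le_one_left (norm_nonneg _) h1)
  let ψ : ℝ → ℝ := fun θ => ∫ p, h (Y θ p) ∂(ν.prod γ)
  have hYint : ∀ θ, Integrable (fun p => h (Y θ p)) (ν.prod γ) := fun θ =>
    integrable_prod_stdGaussian_of_le (hd.continuous.measurable.comp (hYm θ)) (|h 0| + KF) 1
      fun p => by linarith [hb (Y θ p), hYn θ p]
  have hdm : Measurable (fun q : EuclideanSpace ℝ (Fin k) × EuclideanSpace ℝ (Fin k) =>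
      fderiv ℝ h q.1 q.2) :=
    ((hcf.continuous.comp continuous_fst).clm_apply continuous_snd).measurable
  have hder : ∀ θ, HasDerivAt ψ (∫ p, fderiv ℝ h (Y θ p) (Y' θ p) ∂(ν.prod γ)) θ := by
    intro θ
    refine (hasDerivAt_integral_of_dominated_loc_of_deriv_le (s := Set.univ)
      (F := fun θ p => h (Y θ p)) (F' := fun θ p => fderiv ℝ h (Y θ p) (Y' θ p))
      (bound := fun p => KF + ‖p.2‖) Filter.univ_mem
      (Filter.Eventually.of_forall fun θ => (hYint θ).aestronglyMeasurable) (hYint θ)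
      (hdm.comp ((hYm θ).prodMk (by fun_prop))).aestronglyMeasurable
      (Filter.Eventually.of_forall fun p θ _ => ?_)
      ((integrable_const _).add (integrable_norm_stdGaussian.comp_snd ν))
      (Filter.Eventually.of_forall fun p θ _ => ?_)).2
    · refine ((fderiv ℝ h _).le_of_opNorm_le (hd1 _) _).trans ?_
      rw [one_mul]
      exact hYn' θ p
    · have h1 : HasDerivAt (fun θ => Y θ p) (Y' θ p) θ := by
        refine (((Real.hasDerivAt_sin θ).smul_const (F p.1)).add
          ((Real.hasDerivAt_cos θ).smul_const p.2)).congr_deriv ?_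
        simp only [Y']
        module
      exact (hd (Y θ p)).hasFDerivAt.comp_hasDerivAt θ h1
  -- the derivative, after the integrations by parts
  let Z : T × EuclideanSpace ℝ (Fin k) → EuclideanSpace ℝ (Fin k) :=
    fun p => WithLp.toLp 2 ((A p.1 - 1) *ᵥ p.2)
  have hcoord : ∀ w v : EuclideanSpace ℝ (Fin k),
      fderiv ℝ h w v = ∑ r, v r * fderiv ℝ h w (EuclideanSpace.single r 1) := fun w v => by
    conv_lhs => rw [← (EuclideanSpace.basisFun (Fin k) ℝ).sum_repr v]
    simp [map_sum]
  -- The partial derivatives of h are the test functions for the integrations by parts; the bound C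
  -- on the second derivative makes them admissible.
  let φ : Fin k → EuclideanSpace ℝ (Fin k) → ℝ :=
    fun r w => fderiv ℝ h w (EuclideanSpace.single r 1)
  have hφc : ∀ r, ContDiff ℝ 1 (φ r) := fun r => hcf.clm_apply contDiff_const
  have hφm : ∀ r, Measurable (φ r) := fun r => (hφc r).continuous.measurable
  have hφ1 : ∀ r w, |φ r w| ≤ 1 := fun r w => by
    simpa using (fderiv ℝ h w).le_of_opNorm_le (hd1 w) (EuclideanSpace.single r 1)
  have hφ2 : ∀ r w, ‖fderiv ℝ (φ r) w‖ ≤ C := fun r w => by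
    have h1 : HasFDerivAt (φ r) _ w :=
      (hcf.differentiable one_ne_zero w).hasFDerivAt.clm_apply
        (hasFDerivAt_const (EuclideanSpace.single r 1) w)
    refine ContinuousLinearMap.opNorm_le_bound _
      ((ContinuousLinearMap.opNorm_nonneg _).trans (hC w)) fun v => ?_
    rw [h1.fderiv]
    have h2 := (fderiv ℝ (fderiv ℝ h) w v).le_of_opNorm_le
      ((fderiv ℝ (fderiv ℝ h) w).le_of_opNorm_le (hC w) v) (EuclideanSpace.single r 1)
    simpa using h2
  have hZ : ∀ p r, Z p r = ∑ s, (A p.1 - 1) r s * p.2 s := fun _ _ => rfl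
  have hZm : Measurable Z := by
    refine (PiLp.continuous_toLp 2 _).measurable.comp (measurable_pi_lambda _ fun r => ?_)
    have : Measurable fun p : T × EuclideanSpace ℝ (Fin k) =>
        ∑ s, (A p.1 - 1) r s * p.2 s :=
      Finset.measurable_sum _ fun s _ => Measurable.mul
        (((hAm r s).comp measurable_fst).sub_const _) (by fun_prop)
    exact this
  have hZi : Integrable Z (ν.prod γ) := by
    refine ((integrable_norm_stdGaussian.comp_snd ν).const_mul
      (∑ _r : Fin k, ∑ _s : Fin k, (KA + 1))).mono'
      hZm.aestronglyMeasurable (Filter.Eventually.of_forall fun p => ?_)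
    have h1 : ‖Z p‖ ≤ ∑ r, |Z p r| := by
      conv_lhs => rw [← (EuclideanSpace.basisFun (Fin k) ℝ).sum_repr (Z p)]
      refine (norm_sum_le _ _).trans (Finset.sum_le_sum fun r _ => ?_)
      simp [norm_smul]
    refine h1.trans ?_
    simp only [Finset.sum_mul]
    refine Finset.sum_le_sum fun r _ => ?_
    rw [hZ]
    refine (Finset.abs_sum_le_sum_abs _ _).trans (Finset.sum_le_sum fun s _ => ?_)
    rw [abs_mul]
    refine mul_le_mul ?_ (PiLp.norm_apply_le p.2 s) (abs_nonneg _)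
      (by linarith [(abs_nonneg _).trans (hKA p.1 r s)])
    rw [Matrix.sub_apply]
    refine (abs_sub _ _).trans (add_le_add (hKA p.1 r s) ?_)
    rw [Matrix.one_apply]
    split_ifs <;> simp
  have hder' : ∀ θ, ∫ p, fderiv ℝ h (Y θ p) (Y' θ p) ∂(ν.prod γ) =
      Real.sin θ * ∫ p, fderiv ℝ h (Y θ p) (Z p) ∂(ν.prod γ) := by
    intro θ
    have iF : ∀ r, Integrable (fun p => F p.1 r * φ r (Y θ p)) (ν.prod γ) := fun r =>
      integrable_prod_stdGaussian_of_le (Measurable.mul (by fun_prop) ((hφm r).comp (hYm θ))) KF 0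
        fun p => by
          rw [abs_mul, zero_mul, add_zero, ← mul_one KF]
          exact mul_le_mul ((PiLp.norm_apply_le (F p.1) r).trans (hKF _)) (hφ1 r _)
            (abs_nonneg _) ((norm_nonneg _).trans (hKF p.1))
    have iz : ∀ r, Integrable (fun p => p.2 r * φ r (Y θ p)) (ν.prod γ) := fun r =>
      integrable_prod_stdGaussian_of_le (Measurable.mul (by fun_prop) ((hφm r).comp (hYm θ))) 0 1
        fun p => by
          rw [abs_mul, zero_add, one_mul]
          exact (mul_le_of_le_one_right (abs_nonneg _) (hφ1 r _)).trans (PiLp.norm_apply_le p.2 r)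
    have iZ : ∀ r, Integrable (fun p => Z p r * φ r (Y θ p)) (ν.prod γ) := fun r =>
      hZi.norm.mono' (Measurable.mul (by fun_prop) ((hφm r).comp (hYm θ))).aestronglyMeasurable
        (Filter.Eventually.of_forall fun p => by
          rw [norm_mul]
          exact (mul_le_of_le_one_right (norm_nonneg _) (hφ1 r _)).trans (PiLp.norm_apply_le _ r))
    -- Trade F for AZ and split AZ = (A - 1)Z + Z; the last summand will cancel the second term of
    -- the derivative.
    have key : ∀ r, Real.cos θ * ∫ p, F p.1 r * φ r (Y θ p) ∂(ν.prod γ) =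
        Real.sin θ * (∫ p, Z p r * φ r (Y θ p) ∂(ν.prod γ) +
          ∫ p, p.2 r * φ r (Y θ p) ∂(ν.prod γ)) := fun r => by
      rw [hA.integral_coord_mul_comp r (hφc r) (hφ1 r) (hφ2 r) (Real.sin θ) (Real.cos θ),
        ← integral_add (iZ r) (iz r)]
      congr 2 with p
      rw [← add_mul]
      congr 1
      rw [hZ]
      simp [Matrix.sub_apply, sub_mul, Finset.sum_sub_distrib, Matrix.one_apply]
    have e1 : ∀ p, fderiv ℝ h (Y θ p) (Y' θ p) = ∑ r, (Real.cos θ * (F p.1 r * φ r (Y θ p)) -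
        Real.sin θ * (p.2 r * φ r (Y θ p))) := fun p => by
      rw [hcoord]
      refine Finset.sum_congr rfl fun r _ => ?_
      simp only [Y', PiLp.sub_apply, PiLp.smul_apply, smul_eq_mul, φ]
      ring
    have e2 : ∀ p, fderiv ℝ h (Y θ p) (Z p) = ∑ r, Z p r * φ r (Y θ p) := fun p => hcoord _ _
    simp only [e1, e2]
    have iS : ∀ r, Integrable (fun p => Real.cos θ * (F p.1 r * φ r (Y θ p)) -
        Real.sin θ * (p.2 r * φ r (Y θ p))) (ν.prod γ) := fun r =>
      ((iF r).const_mul _).sub ((iz r).const_mul _)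
    rw [integral_finsetSum _ fun r _ => iS r,
      integral_finsetSum _ fun r _ => iZ r, Finset.mul_sum]
    refine Finset.sum_congr rfl fun r _ => ?_
    rw [integral_sub ((iF r).const_mul _) ((iz r).const_mul _), integral_const_mul,
      integral_const_mul, key r]
    ring
  have hZle : ∀ θ, |∫ p, fderiv ℝ h (Y θ p) (Z p) ∂(ν.prod γ)| ≤ D := by
    intro θ
    calc |∫ p, fderiv ℝ h (Y θ p) (Z p) ∂(ν.prod γ)| ≤ ∫ p, ‖Z p‖ ∂(ν.prod γ) :=
          norm_integral_le_of_norm_le (f := fun p => fderiv ℝ h (Y θ p) (Z p)) hZi.norm (Filter.Eventually.of_forall fun p => by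
            simpa using (fderiv ℝ h _).le_of_opNorm_le (hd1 (Y θ p)) (Z p))
      _ = ∫ x, ∫ z, ‖Z (x, z)‖ ∂γ ∂ν := integral_prod _ hZi.norm
      _ ≤ D := integral_mono hZi.norm.integral_prod_left ((memLp_steinDiscrepancy hA).integrable one_le_two)
          fun x => integral_norm_mulVec_stdGaussian_le (A x - 1)
  have hψ1 : ψ (Real.pi / 2) = ∫ x, h (F x) ∂ν := by
    simp only [ψ, Y, Real.sin_pi_div_two, Real.cos_pi_div_two, one_smul, zero_smul, add_zero]
    simpa using integral_fun_fst (μ := ν) (ν := γ) (fun x => h (F x))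
  have hψ0 : ψ 0 = ∫ z, h z ∂γ := by
    simp only [ψ, Y, Real.sin_zero, Real.cos_zero, one_smul, zero_smul, zero_add]
    simpa using integral_fun_snd (μ := ν) (ν := γ) h
  -- D(1 - cos θ) is the primitive of the bound D sin θ which vanishes at 0; it takes the value D at
  -- π/2.
  have hB : ∀ θ, HasDerivAt (fun θ => D * (1 - Real.cos θ)) (D * Real.sin θ) θ := fun θ => by
    simpa using ((Real.hasDerivAt_cos θ).const_sub 1).const_mul D
  have := image_norm_le_of_norm_deriv_right_le_deriv_boundary (f := fun θ => ψ θ - ψ 0)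
    (a := 0) (b := Real.pi / 2)
    (fun θ _ => ((hder θ).sub_const _).continuousAt.continuousWithinAt)
    (fun θ _ => ((hder θ).sub_const _).hasDerivWithinAt)
    (B := fun θ => D * (1 - Real.cos θ)) (by simp) hB
    (fun θ hθ => by
      have hs : 0 ≤ Real.sin θ := Real.sin_nonneg_of_nonneg_of_le_pi hθ.1
        (by linarith [hθ.2, Real.pi_pos])
      rw [hder', norm_mul, Real.norm_of_nonneg hs, mul_comm]
      exact mul_le_mul_of_nonneg_right (hZle θ) hs)
    (Set.right_mem_Icc.2 (by positivity))
  simpa [hψ1, hψ0] using this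

/-- A Lipschitz g is replaced by a smooth h within ε/2 uniformly; each of the two expectations then
changes by at most ε/2. -/
theorem IsSteinKernel.wassersteinDist_le {ν : Measure T} [IsProbabilityMeasure ν]
    {F : T → EuclideanSpace ℝ (Fin k)} {A : T → Matrix (Fin k) (Fin k) ℝ}
    (hA : IsSteinKernel ν F A) :
    wassersteinDist (ν.map F) (stdGaussian (EuclideanSpace ℝ (Fin k))) ≤
      ENNReal.ofReal (∫ x, steinDiscrepancy (A x) ∂ν) := by
  set γ := stdGaussian (EuclideanSpace ℝ (Fin k))
  obtain ⟨KF, hKF⟩ := hA.bounded_fun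
  refine iSup₂_le fun g hg => ENNReal.ofReal_le_ofReal ?_
  rw [integral_map hA.measurable_fun.aemeasurable hg.continuous.aestronglyMeasurable]
  have hlip : ∀ f : EuclideanSpace ℝ (Fin k) → ℝ, LipschitzWith 1 f →
      ∀ z, ‖f z‖ ≤ |f 0| + ‖z‖ := fun f hf z => by
    have := hf.dist_le_mul z 0
    rw [Real.dist_eq, dist_zero_right, NNReal.coe_one, one_mul] at this
    rw [Real.norm_eq_abs]
    linarith [abs_sub_abs_le_abs_sub (f z) (f 0)]
  have hiF : ∀ f : EuclideanSpace ℝ (Fin k) → ℝ, LipschitzWith 1 f →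
      Integrable (fun x => f (F x)) ν := fun f hf =>
    (integrable_const (|f 0| + KF)).mono'
      (hf.continuous.measurable.comp hA.measurable_fun).aestronglyMeasurable
      (Filter.Eventually.of_forall fun x => by linarith [hlip f hf (F x), hKF x])
  have hiγ : ∀ f : EuclideanSpace ℝ (Fin k) → ℝ, LipschitzWith 1 f → Integrable f γ :=
    fun f hf => ((integrable_const |f 0|).add integrable_norm_stdGaussian).mono'
      hf.continuous.aestronglyMeasurable (Filter.Eventually.of_forall (hlip f hf))
  refine le_of_forall_pos_le_add fun ε hε => ?_
  obtain ⟨h, hh, hhl, ⟨C, hC⟩, happ⟩ := exists_contDiff_lipschitzWith_approx hg (half_pos hε)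
  have h1 : |(∫ x, h (F x) ∂ν) - ∫ x, g (F x) ∂ν| ≤ ε / 2 := by
    rw [← integral_sub (hiF h hhl) (hiF g hg)]
    simpa using norm_integral_le_of_norm_le_const (μ := ν) (f := fun x => h (F x) - g (F x))
      (Filter.Eventually.of_forall fun x => happ (F x))
  have h2 : |(∫ z, h z ∂γ) - ∫ z, g z ∂γ| ≤ ε / 2 := by
    rw [← integral_sub (hiγ h hhl) (hiγ g hg)]
    simpa using norm_integral_le_of_norm_le_const (μ := γ) (f := fun z => h z - g z)
      (Filter.Eventually.of_forall happ)
  have h3 := hA.abs_integral_sub_le_of_contDiff hh hhl hC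
  rw [abs_le] at h1 h2 h3 ⊢
  constructor <;> linarith [h1.1, h1.2, h2.1, h2.2, h3.1, h3.2]

end SteinKernel

/-! ### Moments of the uniform distribution on a sphere -/

section SphereMoments

open scoped Pointwise

/-- The bijection of the unit sphere which a linear isometry induces. -/
def sphereIsometry {E : Type*} [NormedAddCommGroup E] [NormedSpace ℝ E] (L : E ≃ₗᵢ[ℝ] E)
    (u : Metric.sphere (0 : E) 1) : Metric.sphere (0 : E) 1 :=
  ⟨L u, by simp⟩

theorem integral_sub_sub {α : Type*} [MeasurableSpace α] {μ : Measure α} {f g h : α → ℝ}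
    (hf : Integrable f μ) (hg : Integrable g μ) (hh : Integrable h μ) :
    ∫ a, f a - g a - h a ∂μ = ∫ a, f a ∂μ - ∫ a, g a ∂μ - ∫ a, h a ∂μ := by
  rw [← integral_sub hf hg]
  exact integral_sub (hf.sub hg) hh

/-- Surface measure of a set is the dimension times the volume of the cone over it; a linear
isometry maps cones to cones and preserves volume. -/
theorem toSphere_map_sphereIsometry {E : Type*} [NormedAddCommGroup E] [InnerProductSpace ℝ E]
    [FiniteDimensional ℝ E] [MeasurableSpace E] [BorelSpace E] (L : E ≃ₗᵢ[ℝ] E) :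
    (volume : Measure E).toSphere.map (sphereIsometry L) = (volume : Measure E).toSphere := by
  have hm : Measurable (sphereIsometry L) :=
    (L.continuous.measurable.comp measurable_subtype_coe).subtype_mk
  ext s hs
  rw [Measure.map_apply hm hs, Measure.toSphere_apply' _ hs, Measure.toSphere_apply' _ (hm hs)]
  congr 1
  have h : Set.Ioo (0 : ℝ) 1 • ((fun u : Metric.sphere (0 : E) 1 => (u : E)) ''
      (sphereIsometry L ⁻¹' s)) =
      L ⁻¹' (Set.Ioo (0 : ℝ) 1 • ((fun u : Metric.sphere (0 : E) 1 => (u : E)) '' s)) := by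
    ext x
    simp only [Set.mem_smul, Set.mem_image, Set.mem_preimage]
    constructor
    · rintro ⟨t, ht, _, ⟨u, hu, rfl⟩, rfl⟩
      exact ⟨t, ht, _, ⟨_, hu, rfl⟩, by simp [sphereIsometry]⟩
    · rintro ⟨t, ht, _, ⟨u, hu, rfl⟩, hx⟩
      refine ⟨t, ht, _, ⟨sphereIsometry L.symm u, ?_, rfl⟩, ?_⟩
      · have : sphereIsometry L (sphereIsometry L.symm u) = u := by
          ext
          simp [sphereIsometry]
        rwa [this]
      · rw [← L.injective.eq_iff, ← hx]
        simp [sphereIsometry]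
  rw [h]
  exact L.measurePreserving.measure_preimage_equiv (f := L.toMeasurableEquiv) _

variable {ι : Type*} [Fintype ι]

theorem measurable_smul_sphere (ρ : ℝ) :
    Measurable (fun u : Metric.sphere (0 : EuclideanSpace ℝ ι) 1 =>
      ρ • (u : EuclideanSpace ℝ ι)) :=
  measurable_subtype_coe.const_smul ρ

theorem uniformSphere_map_linearIsometryEquiv (ρ : ℝ)
    (L : EuclideanSpace ℝ ι ≃ₗᵢ[ℝ] EuclideanSpace ℝ ι) :
    (uniformSphere ι ρ).map L = uniformSphere ι ρ := by
  have hm : Measurable (sphereIsometry L) :=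
    (L.continuous.measurable.comp measurable_subtype_coe).subtype_mk
  rw [uniformSphere, Measure.map_map L.continuous.measurable (measurable_smul_sphere ρ)]
  conv_rhs => rw [← toSphere_map_sphereIsometry L, Measure.map_apply hm .univ, Set.preimage_univ,
    ← Measure.map_smul, Measure.map_map (measurable_smul_sphere ρ) hm]
  congr 1
  ext u
  simp [sphereIsometry]

instance isProbabilityMeasure_uniformSphere [Nonempty ι] (ρ : ℝ) :
    IsProbabilityMeasure (uniformSphere ι ρ) := by
  refine ⟨?_⟩
  rw [uniformSphere, Measure.map_apply (measurable_smul_sphere ρ) .univ, Set.preimage_univ,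
    Measure.smul_apply, smul_eq_mul]
  refine ENNReal.inv_mul_cancel ?_ (measure_ne_top _ _)
  rw [Ne, Measure.measure_univ_eq_zero, Measure.toSphere_eq_zero_iff]
  exact not_subsingleton _

theorem ae_norm_uniformSphere {ρ : ℝ} (hρ : 0 ≤ ρ) :
    ∀ᵐ a ∂(uniformSphere ι ρ), ‖a‖ = ρ := by
  rw [uniformSphere, ae_map_iff (measurable_smul_sphere ρ).aemeasurable
    (measurableSet_eq_fun measurable_norm measurable_const)]
  refine Filter.Eventually.of_forall fun u => ?_
  rw [norm_smul, norm_eq_of_mem_sphere u, mul_one, Real.norm_of_nonneg hρ]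

theorem integrable_uniformSphere [Nonempty ι] {ρ : ℝ} (hρ : 0 ≤ ρ) {f : EuclideanSpace ℝ ι → ℝ}
    (hf : Continuous f) : Integrable f (uniformSphere ι ρ) := by
  obtain ⟨C, hC⟩ := (isCompact_closedBall (0 : EuclideanSpace ℝ ι) ρ).exists_bound_of_continuousOn
    hf.continuousOn
  refine (integrable_const C).mono' hf.aestronglyMeasurable ?_
  filter_upwards [ae_norm_uniformSphere hρ] with a ha
  exact hC a (by simp [ha])

/-- The reflection that exchanges u and v preserves the measure. -/
theorem integral_uniformSphere_comp_inner {ρ : ℝ} (g : ℝ → ℝ) (hg : Continuous g)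
    {u v : EuclideanSpace ℝ ι} (huv : ‖u‖ = ‖v‖) :
    ∫ a, g (inner ℝ u a) ∂(uniformSphere ι ρ) = ∫ a, g (inner ℝ v a) ∂(uniformSphere ι ρ) := by
  set L := (ℝ ∙ (u - v))ᗮ.reflection
  have hL : L u = v := Submodule.reflection_sub huv
  conv_rhs => rw [← uniformSphere_map_linearIsometryEquiv ρ L, integral_map
    L.continuous.measurable.aemeasurable (Continuous.aestronglyMeasurable (by fun_prop))]
  congr 1 with a
  rw [← hL, LinearIsometryEquiv.inner_map_map]

/-- By invariance u may be replaced by a multiple of a fixed basis vector of the same norm, and the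
integral is homogeneous of degree m. The value of c is found later, by summing over a basis. -/
theorem exists_integral_inner_pow_uniformSphere (ρ : ℝ) (m : ℕ) :
    ∃ c : ℝ, ∀ u : EuclideanSpace ℝ ι,
      ∫ a, inner ℝ u a ^ m ∂(uniformSphere ι ρ) = c * ‖u‖ ^ m := by
  classical
  rcases isEmpty_or_nonempty ι with hι | ⟨⟨i⟩⟩
  · refine ⟨∫ a, inner ℝ (0 : EuclideanSpace ℝ ι) a ^ m ∂(uniformSphere ι ρ), fun u => ?_⟩
    rw [Subsingleton.elim u 0]
    rcases m with _ | m <;> simp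
  · refine ⟨∫ a, inner ℝ (EuclideanSpace.single i (1 : ℝ)) a ^ m ∂(uniformSphere ι ρ),
      fun u => ?_⟩
    rw [integral_uniformSphere_comp_inner (fun x => x ^ m) (by fun_prop) (u := u)
      (v := ‖u‖ • EuclideanSpace.single i (1 : ℝ)) (by simp [norm_smul])]
    simp only [inner_smul_left, mul_pow, integral_const_mul]
    simp [mul_comm]

variable [Nonempty ι]

/-- Polarization of the pure second moment; the constant comes from integrating ∑ a_i² = ρ². -/
theorem integral_inner_mul_inner_uniformSphere {ρ : ℝ} (hρ : 0 ≤ ρ) (u v : EuclideanSpace ℝ ι) :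
    ∫ a, inner ℝ u a * inner ℝ v a ∂(uniformSphere ι ρ) =
      ρ ^ 2 / Fintype.card ι * inner ℝ u v := by
  classical
  obtain ⟨c, hc⟩ := exists_integral_inner_pow_uniformSphere (ι := ι) ρ 2
  have hi : ∀ w : EuclideanSpace ℝ ι, Integrable (fun a => inner ℝ w a ^ 2) (uniformSphere ι ρ) :=
    fun w => integrable_uniformSphere hρ (by fun_prop)
  have hcv : c = ρ ^ 2 / Fintype.card ι := by
    have h1 : ∑ i, ∫ a, inner ℝ (EuclideanSpace.single i (1 : ℝ)) a ^ 2 ∂(uniformSphere ι ρ) =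
        ρ ^ 2 := by
      rw [← integral_finsetSum _ fun i _ => hi _]
      have : ∀ᵐ a ∂(uniformSphere ι ρ),
          ∑ i, inner ℝ (EuclideanSpace.single i (1 : ℝ)) a ^ 2 = ρ ^ 2 := by
        filter_upwards [ae_norm_uniformSphere hρ] with a ha
        rw [← ha, EuclideanSpace.real_norm_sq_eq]
        simp [EuclideanSpace.inner_single_left]
      rw [integral_congr_ae this]
      simp
    simp only [hc] at h1
    simp at h1
    rw [← h1]
    field_simp
  have e : ∀ a : EuclideanSpace ℝ ι, inner ℝ u a * inner ℝ v a =
      (inner ℝ (u + v) a ^ 2 - inner ℝ u a ^ 2 - inner ℝ v a ^ 2) / 2 := fun a => by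
    rw [inner_add_left]
    ring
  simp only [e]
  rw [integral_div, integral_sub_sub (hi _) (hi _) (hi _), hc, hc, hc,
    hcv, @norm_add_sq_real]
  ring

/-- The pure fourth moment c‖u‖⁴ is polarized in stages, through the products with two squares and
with one square, and yields c/3 times the sum over the three pairings, as for a Gaussian vector.
Integrating (∑ a_i²)² = ρ⁴ determines c/3: over a basis with N elements the pairings sum to N² + 2N.
-/
theorem integral_inner_four_uniformSphere {ρ : ℝ} (hρ : 0 ≤ ρ) (u v w y : EuclideanSpace ℝ ι) :
    ∫ a, inner ℝ u a * inner ℝ v a * inner ℝ w a * inner ℝ y a ∂(uniformSphere ι ρ) =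
      ρ ^ 4 / (Fintype.card ι * (Fintype.card ι + 2)) *
        (inner ℝ u v * inner ℝ w y + inner ℝ u w * inner ℝ v y + inner ℝ u y * inner ℝ v w) := by
  classical
  obtain ⟨c, hc⟩ := exists_integral_inner_pow_uniformSphere (ι := ι) ρ 4
  have hi : ∀ u v : EuclideanSpace ℝ ι,
      Integrable (fun a => inner ℝ u a ^ 2 * inner ℝ v a ^ 2) (uniformSphere ι ρ) :=
    fun u v => integrable_uniformSphere hρ (by fun_prop)
  have hi4 : ∀ u : EuclideanSpace ℝ ι,
      Integrable (fun a => inner ℝ u a ^ 4) (uniformSphere ι ρ) :=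
    fun u => integrable_uniformSphere hρ (by fun_prop)
  have h22 : ∀ u v : EuclideanSpace ℝ ι,
      ∫ a, inner ℝ u a ^ 2 * inner ℝ v a ^ 2 ∂(uniformSphere ι ρ) =
        c / 3 * (inner ℝ u u * inner ℝ v v + 2 * inner ℝ u v ^ 2) := fun u v => by
    -- In (s + t)⁴ + (s - t)⁴ the odd terms cancel, leaving 2s⁴ + 12s²t² + 2t⁴.
    have e : ∀ a : EuclideanSpace ℝ ι, inner ℝ u a ^ 2 * inner ℝ v a ^ 2 =
        (inner ℝ (u + v) a ^ 4 + inner ℝ (u - v) a ^ 4 - 2 * inner ℝ u a ^ 4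
          - 2 * inner ℝ v a ^ 4) / 12 := fun a => by
      rw [inner_add_left, inner_sub_left]
      ring
    simp only [e]
    rw [integral_div, integral_sub_sub
      (f := fun a => inner ℝ (u + v) a ^ 4 + inner ℝ (u - v) a ^ 4) ((hi4 _).add (hi4 _))
      ((hi4 _).const_mul 2) ((hi4 _).const_mul 2),
      integral_add (hi4 _) (hi4 _), integral_const_mul, integral_const_mul, hc, hc, hc, hc]
    have h4 : ∀ x : EuclideanSpace ℝ ι, ‖x‖ ^ 4 = inner ℝ x x ^ 2 := fun x => by
      rw [real_inner_self_eq_norm_sq]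
      ring
    simp only [h4, inner_add_left, inner_add_right, inner_sub_left, inner_sub_right,
      real_inner_comm u v]
    ring
  have hcv : c / 3 = ρ ^ 4 / (Fintype.card ι * (Fintype.card ι + 2)) := by
    have h1 : ∑ i, ∑ j, ∫ a, inner ℝ (EuclideanSpace.single i (1 : ℝ)) a ^ 2 *
        inner ℝ (EuclideanSpace.single j (1 : ℝ)) a ^ 2 ∂(uniformSphere ι ρ) = ρ ^ 4 := by
      simp only [← integral_finsetSum _ fun j _ => hi _ _]
      rw [← integral_finsetSum _ fun i _ => integrable_finsetSum _ fun j _ => hi _ _]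
      have : ∀ᵐ a ∂(uniformSphere ι ρ),
          ∑ i, ∑ j, inner ℝ (EuclideanSpace.single i (1 : ℝ)) a ^ 2 *
            inner ℝ (EuclideanSpace.single j (1 : ℝ)) a ^ 2 = ρ ^ 4 := by
        filter_upwards [ae_norm_uniformSphere hρ] with a ha
        rw [← Finset.sum_mul_sum, ← ha, show ‖a‖ ^ 4 = ‖a‖ ^ 2 * ‖a‖ ^ 2 by ring,
          EuclideanSpace.real_norm_sq_eq]
        simp [EuclideanSpace.inner_single_left]
      rw [integral_congr_ae this]
      simp
    simp only [h22, ← Finset.mul_sum] at h1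
    have h2 : ∑ i : ι, ∑ j : ι, (inner ℝ (EuclideanSpace.single i (1 : ℝ))
        (EuclideanSpace.single i (1 : ℝ)) * inner ℝ (EuclideanSpace.single j (1 : ℝ))
        (EuclideanSpace.single j (1 : ℝ)) + 2 * inner ℝ (EuclideanSpace.single i (1 : ℝ))
        (EuclideanSpace.single j (1 : ℝ)) ^ 2) =
        (Fintype.card ι : ℝ) * (Fintype.card ι + 2) := by
      simp [EuclideanSpace.inner_single_left, Finset.sum_add_distrib]
      ring
    rw [h2] at h1
    rw [← h1]
    field_simp
  have h112 : ∀ u v w : EuclideanSpace ℝ ι,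
      ∫ a, inner ℝ u a * inner ℝ v a * inner ℝ w a ^ 2 ∂(uniformSphere ι ρ) =
        c / 3 * (inner ℝ u v * inner ℝ w w + 2 * inner ℝ u w * inner ℝ v w) := fun u v w => by
    have e : ∀ a : EuclideanSpace ℝ ι, inner ℝ u a * inner ℝ v a * inner ℝ w a ^ 2 =
        (inner ℝ (u + v) a ^ 2 * inner ℝ w a ^ 2 - inner ℝ u a ^ 2 * inner ℝ w a ^ 2
          - inner ℝ v a ^ 2 * inner ℝ w a ^ 2) / 2 := fun a => by
      rw [inner_add_left]
      ring
    simp only [e]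
    rw [integral_div, integral_sub_sub (hi _ _) (hi _ _) (hi _ _), h22, h22, h22]
    simp only [inner_add_left, inner_add_right, real_inner_comm u v]
    ring
  have hi' : ∀ w : EuclideanSpace ℝ ι,
      Integrable (fun a => inner ℝ u a * inner ℝ v a * inner ℝ w a ^ 2) (uniformSphere ι ρ) :=
    fun w => integrable_uniformSphere hρ (by fun_prop)
  have e : ∀ a : EuclideanSpace ℝ ι, inner ℝ u a * inner ℝ v a * inner ℝ w a * inner ℝ y a =
      (inner ℝ u a * inner ℝ v a * inner ℝ (w + y) a ^ 2
        - inner ℝ u a * inner ℝ v a * inner ℝ w a ^ 2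
        - inner ℝ u a * inner ℝ v a * inner ℝ y a ^ 2) / 2 := fun a => by
    rw [inner_add_left]
    ring
  simp only [e]
  rw [integral_div, integral_sub_sub (hi' _) (hi' _) (hi' _),
    h112, h112, h112, ← hcv]
  simp only [inner_add_left, inner_add_right, real_inner_comm w y]
  ring

variable [DecidableEq ι]

theorem integral_coord_mul_coord_uniformSphere {ρ : ℝ} (hρ : 0 ≤ ρ) (i j : ι) :
    ∫ a, a i * a j ∂(uniformSphere ι ρ) = ρ ^ 2 / Fintype.card ι * if i = j then 1 else 0 := by
  have := integral_inner_mul_inner_uniformSphere hρ (EuclideanSpace.single i (1 : ℝ))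
    (EuclideanSpace.single j (1 : ℝ))
  simpa [EuclideanSpace.inner_single_left] using this

theorem integral_coord_four_uniformSphere {ρ : ℝ} (hρ : 0 ≤ ρ) (i j l m : ι) :
    ∫ a, a i * a j * a l * a m ∂(uniformSphere ι ρ) =
      ρ ^ 4 / (Fintype.card ι * (Fintype.card ι + 2)) *
        ((if i = j then 1 else 0) * (if l = m then 1 else 0) +
          (if i = l then 1 else 0) * (if j = m then 1 else 0) +
          (if i = m then 1 else 0) * (if j = l then 1 else 0)) := by
  have := integral_inner_four_uniformSphere hρ (EuclideanSpace.single i (1 : ℝ))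
    (EuclideanSpace.single j (1 : ℝ)) (EuclideanSpace.single l (1 : ℝ))
    (EuclideanSpace.single m (1 : ℝ))
  simpa [EuclideanSpace.inner_single_left, mul_comm] using this

end SphereMoments

/-! ### Trigonometric integrals and integration by parts on the torus -/

section Torus

variable {n k : ℕ}

instance : IsProbabilityMeasure (volume : Measure (UnitAddTorus (Fin n))) := by
  refine ⟨?_⟩
  rw [volume_pi, Measure.pi_univ]
  simp

theorem measurable_torusRep : Measurable (torusRep (n := n)) :=
  measurable_pi_lambda _ fun i => measurable_subtype_coe.comp
    ((AddCircle.measurableEquivIco 1 0).measurable.comp (measurable_pi_apply i))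

theorem torusProj_torusRep (x : UnitAddTorus (Fin n)) : torusProj (torusRep x) = x :=
  funext fun _ => AddCircle.coe_equivIco

theorem torusProj_add (y z : Fin n → ℝ) : torusProj (y + z) = torusProj y + torusProj z :=
  funext fun _ => AddCircle.coe_add 1 _ _

theorem torusRep_torusProj (y : Fin n → ℝ) : ∃ l : Fin n → ℤ,
    torusRep (torusProj y) = y + fun i => (l i : ℝ) := by
  refine ⟨fun i => -⌊y i⌋, funext fun i => ?_⟩
  have h : torusRep (torusProj y) i = Int.fract (y i) := by
    simp only [torusRep, torusProj]
    rw [AddCircle.coe_equivIco_mk_apply]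
    simp
  rw [h, Int.fract]
  simp [sub_eq_add_neg]

/-- The vector `u` has integer components. -/
def IsIntegerVec (u : Fin n → ℝ) : Prop := ∀ i, ∃ m : ℤ, u i = m

theorem IsIntegerVec.exists_dotProduct {u : Fin n → ℝ} (hu : IsIntegerVec u) (l : Fin n → ℤ) :
    ∃ m : ℤ, (u ⬝ᵥ fun i => (l i : ℝ)) = m := by
  choose m hm using hu
  refine ⟨∑ i, m i * l i, ?_⟩
  simp [dotProduct, hm]

theorem IsIntegerVec.add {u v : Fin n → ℝ} (hu : IsIntegerVec u) (hv : IsIntegerVec v) :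
    IsIntegerVec (u + v) := fun i => by
  obtain ⟨a, ha⟩ := hu i
  obtain ⟨b, hb⟩ := hv i
  exact ⟨a + b, by simp [ha, hb]⟩

theorem IsIntegerVec.sub {u v : Fin n → ℝ} (hu : IsIntegerVec u) (hv : IsIntegerVec v) :
    IsIntegerVec (u - v) := fun i => by
  obtain ⟨a, ha⟩ := hu i
  obtain ⟨b, hb⟩ := hv i
  exact ⟨a - b, by simp [ha, hb]⟩

/-- The function `x ↦ cos (2 π ⟨u, x⟩)` on the torus. -/
noncomputable def torusCos (u : Fin n → ℝ) (x : UnitAddTorus (Fin n)) : ℝ :=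
  Real.cos (2 * Real.pi * (u ⬝ᵥ torusRep x))

/-- The function `x ↦ sin (2 π ⟨u, x⟩)` on the torus. -/
noncomputable def torusSin (u : Fin n → ℝ) (x : UnitAddTorus (Fin n)) : ℝ :=
  Real.sin (2 * Real.pi * (u ⬝ᵥ torusRep x))

theorem IsIntegerVec.exists_dotProduct_torusRep {u : Fin n → ℝ} (hu : IsIntegerVec u)
    (y : Fin n → ℝ) : ∃ m : ℤ, 2 * Real.pi * (u ⬝ᵥ torusRep (torusProj y)) =
      2 * Real.pi * (u ⬝ᵥ y) + m * (2 * Real.pi) := by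
  obtain ⟨l, hl⟩ := torusRep_torusProj y
  obtain ⟨m, hm⟩ := hu.exists_dotProduct l
  refine ⟨m, ?_⟩
  rw [hl, dotProduct_add, hm]
  ring

theorem torusCos_torusProj {u : Fin n → ℝ} (hu : IsIntegerVec u) (y : Fin n → ℝ) :
    torusCos u (torusProj y) = Real.cos (2 * Real.pi * (u ⬝ᵥ y)) := by
  obtain ⟨m, hm⟩ := hu.exists_dotProduct_torusRep y
  rw [torusCos, hm, Real.cos_add_int_mul_two_pi]

theorem torusSin_torusProj {u : Fin n → ℝ} (hu : IsIntegerVec u) (y : Fin n → ℝ) :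
    torusSin u (torusProj y) = Real.sin (2 * Real.pi * (u ⬝ᵥ y)) := by
  obtain ⟨m, hm⟩ := hu.exists_dotProduct_torusRep y
  rw [torusSin, hm, Real.sin_add_int_mul_two_pi]

theorem torusCos_add_torusProj {u : Fin n → ℝ} (hu : IsIntegerVec u) (x : UnitAddTorus (Fin n))
    (y : Fin n → ℝ) : torusCos u (x + torusProj y) =
      Real.cos (2 * Real.pi * (u ⬝ᵥ torusRep x + u ⬝ᵥ y)) := by
  rw [← dotProduct_add, ← torusCos_torusProj hu, torusProj_add, torusProj_torusRep]

theorem torusSin_add_torusProj {u : Fin n → ℝ} (hu : IsIntegerVec u) (x : UnitAddTorus (Fin n))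
    (y : Fin n → ℝ) : torusSin u (x + torusProj y) =
      Real.sin (2 * Real.pi * (u ⬝ᵥ torusRep x + u ⬝ᵥ y)) := by
  rw [← dotProduct_add, ← torusSin_torusProj hu, torusProj_add, torusProj_torusRep]

@[fun_prop]
theorem measurable_torusCos (u : Fin n → ℝ) : Measurable (torusCos u) := by
  refine Real.measurable_cos.comp (Measurable.const_mul ?_ _)
  exact Measurable.comp (g := fun y : Fin n → ℝ => u ⬝ᵥ y)
    (Continuous.measurable (by fun_prop)) measurable_torusRep

@[fun_prop]
theorem measurable_torusSin (u : Fin n → ℝ) : Measurable (torusSin u) := by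
  refine Real.measurable_sin.comp (Measurable.const_mul ?_ _)
  exact Measurable.comp (g := fun y : Fin n → ℝ => u ⬝ᵥ y)
    (Continuous.measurable (by fun_prop)) measurable_torusRep

theorem abs_torusCos_le_one (u : Fin n → ℝ) (x : UnitAddTorus (Fin n)) : |torusCos u x| ≤ 1 :=
  Real.abs_cos_le_one _

theorem abs_torusSin_le_one (u : Fin n → ℝ) (x : UnitAddTorus (Fin n)) : |torusSin u x| ≤ 1 :=
  Real.abs_sin_le_one _

theorem integrable_torusCos (u : Fin n → ℝ) : Integrable (torusCos u) :=
  (integrable_const (1 : ℝ)).mono' (measurable_torusCos u).aestronglyMeasurable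
    (Filter.Eventually.of_forall (abs_torusCos_le_one u))

/-- A translation by half a period changes the sign of the function, whereas the measure is
translation invariant. -/
theorem integral_torusCos {u : Fin n → ℝ} (hu : IsIntegerVec u) (h0 : u ≠ 0) :
    ∫ x, torusCos u x = 0 := by
  obtain ⟨i, hi⟩ := Function.ne_iff.1 h0
  -- Moving by 1/(2u_i) along axis i changes ⟨u, x⟩ by 1/2, that is, the phase by π.
  have h1 : u ⬝ᵥ Pi.single i (1 / (2 * u i)) = 1 / 2 := by
    rw [dotProduct_single]
    have : u i ≠ 0 := hi
    field_simp
  have h2 : ∀ x, torusCos u (x + torusProj (Pi.single i (1 / (2 * u i)))) = -torusCos u x := by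
    intro x
    rw [torusCos_add_torusProj hu, h1, torusCos, ← Real.cos_add_pi]
    congr 1
    ring
  have h3 := integral_add_right_eq_self (μ := (volume : Measure (UnitAddTorus (Fin n))))
    (torusCos u) (torusProj (Pi.single i (1 / (2 * u i))))
  simp only [h2, integral_neg] at h3
  linarith

theorem torusCos_zero (x : UnitAddTorus (Fin n)) : torusCos 0 x = 1 := by
  simp [torusCos]

theorem torusCos_mul_torusCos (u v : Fin n → ℝ) (x : UnitAddTorus (Fin n)) :
    torusCos u x * torusCos v x = (torusCos (u + v) x + torusCos (u - v) x) / 2 := by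
  simp only [torusCos, add_dotProduct, sub_dotProduct, mul_add, mul_sub, Real.cos_add,
    Real.cos_sub]
  ring

theorem torusSin_sq (u : Fin n → ℝ) (x : UnitAddTorus (Fin n)) :
    torusSin u x ^ 2 = (1 - torusCos (u + u) x) / 2 := by
  simp only [torusSin, torusCos, add_dotProduct, mul_add, Real.cos_add]
  have := Real.sin_sq_add_cos_sq (2 * Real.pi * (u ⬝ᵥ torusRep x))
  linear_combination (1 / 2) * this

theorem add_self_ne_zero_of_ne_zero {u : Fin n → ℝ} (hu : u ≠ 0) : u + u ≠ 0 := fun h => hu <| by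
  rw [← two_smul ℝ u] at h
  exact (smul_eq_zero.1 h).resolve_left two_ne_zero

theorem integral_torusCos_mul_torusCos {u v : Fin n → ℝ} (hu : IsIntegerVec u) (hv : IsIntegerVec v)
    (h : u + v ≠ 0) : ∫ x, torusCos u x * torusCos v x = if u = v then 1 / 2 else 0 := by
  simp only [torusCos_mul_torusCos]
  rw [integral_div, integral_add (integrable_torusCos _) (integrable_torusCos _),
    integral_torusCos (hu.add hv) h]
  split_ifs with huv
  · subst huv
    simp [torusCos_zero]
  · rw [integral_torusCos (hu.sub hv) (sub_ne_zero.2 huv)]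
    simp

theorem integral_torusSin_sq {u : Fin n → ℝ} (hu : IsIntegerVec u) (h : u ≠ 0) :
    ∫ x, torusSin u x ^ 2 = 1 / 2 := by
  simp only [torusSin_sq]
  rw [integral_div, integral_sub (integrable_const _) (integrable_torusCos _),
    integral_torusCos (hu.add hu) (add_self_ne_zero_of_ne_zero h)]
  simp

/-- Write each sin² through the cosine of the doubled frequency. The linear terms integrate to 0,
and the product of the cosines contributes only for u = v, since 2u + 2v ≠ 0. -/
theorem integral_torusSin_sq_mul_torusSin_sq {u v : Fin n → ℝ} (hu : IsIntegerVec u)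
    (hv : IsIntegerVec v) (hu0 : u ≠ 0) (hv0 : v ≠ 0) (h : u + v ≠ 0) :
    ∫ x, torusSin u x ^ 2 * torusSin v x ^ 2 = 1 / 4 + if u = v then 1 / 8 else 0 := by
  have e : ∀ x, torusSin u x ^ 2 * torusSin v x ^ 2 =
      (1 - torusCos (u + u) x - torusCos (v + v) x) / 4 +
        torusCos (u + u) x * torusCos (v + v) x / 4 := fun x => by
    rw [torusSin_sq, torusSin_sq]
    ring
  have hne : u + u + (v + v) ≠ 0 := by
    rw [add_add_add_comm]
    exact add_self_ne_zero_of_ne_zero h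
  have hiff : u + u = v + v ↔ u = v := by
    refine ⟨fun huv => ?_, fun huv => by rw [huv]⟩
    rw [← two_smul ℝ u, ← two_smul ℝ v] at huv
    exact smul_right_injective _ two_ne_zero huv
  have hi : Integrable fun x => torusCos (u + u) x * torusCos (v + v) x := by
    simp only [torusCos_mul_torusCos]
    exact ((integrable_torusCos _).add (integrable_torusCos _)).div_const 2
  simp only [e]
  rw [integral_add (f := fun x => (1 - torusCos (u + u) x - torusCos (v + v) x) / 4)
    ((((integrable_const _).sub (integrable_torusCos _)).sub
      (integrable_torusCos _)).div_const 4) (hi.div_const 4), integral_div, integral_div,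
    integral_sub_sub (integrable_const _) (integrable_torusCos _) (integrable_torusCos _),
    integral_torusCos (hu.add hu) (add_self_ne_zero_of_ne_zero hu0),
    integral_torusCos (hv.add hv) (add_self_ne_zero_of_ne_zero hv0),
    integral_torusCos_mul_torusCos (hu.add hu) (hv.add hv) hne]
  simp only [hiff]
  split_ifs <;> norm_num

/-- By translation invariance t ↦ ∫ H(x + ty) dx is constant, and its derivative at 0 is ∫ H'.
Applied to a product, this is integration by parts without boundary terms. -/
theorem integral_eq_zero_of_hasDerivAt_torus {H H' : UnitAddTorus (Fin n) → ℝ} (y : Fin n → ℝ)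
    (hH : Measurable H) (hH' : Measurable H') {K C : ℝ} (hK : ∀ x, |H x| ≤ K)
    (hC : ∀ x, |H' x| ≤ C)
    (hder : ∀ x t, HasDerivAt (fun t : ℝ => H (x + torusProj (t • y)))
      (H' (x + torusProj (t • y))) t) : ∫ x, H' x = 0 := by
  have h := (hasDerivAt_integral_of_dominated_loc_of_deriv_le (s := Set.univ) (x₀ := (0 : ℝ))
      (μ := (volume : Measure (UnitAddTorus (Fin n))))
      (F := fun t x => H (x + torusProj (t • y))) (F' := fun t x => H' (x + torusProj (t • y)))
      (bound := fun _ => C) Filter.univ_mem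
      (Filter.Eventually.of_forall fun t =>
        (hH.comp (measurable_add_const _)).aestronglyMeasurable)
      ((integrable_const K).mono' (hH.comp (measurable_add_const _)).aestronglyMeasurable
        (Filter.Eventually.of_forall fun x => hK _))
      (hH'.comp (measurable_add_const _)).aestronglyMeasurable
      (Filter.Eventually.of_forall fun x t _ => hC _) (integrable_const _)
      (Filter.Eventually.of_forall fun x t _ => hder x t)).2
  simp only [integral_add_right_eq_self] at h
  have h1 : ∫ x, H' (x + torusProj ((0 : ℝ) • y)) = ∫ x, H' x :=
    integral_add_right_eq_self _ _
  exact h.unique (hasDerivAt_const _ _)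

theorem hasDerivAt_torusCos {u : Fin n → ℝ} (hu : IsIntegerVec u) (y : Fin n → ℝ)
    (x : UnitAddTorus (Fin n)) (t : ℝ) :
    HasDerivAt (fun t : ℝ => torusCos u (x + torusProj (t • y)))
      (-(2 * Real.pi * (u ⬝ᵥ y)) * torusSin u (x + torusProj (t • y))) t := by
  simp only [torusCos_add_torusProj hu, torusSin_add_torusProj hu, dotProduct_smul, smul_eq_mul]
  have h : HasDerivAt (fun t : ℝ => 2 * Real.pi * (u ⬝ᵥ torusRep x + t * (u ⬝ᵥ y)))
      (2 * Real.pi * (u ⬝ᵥ y)) t := by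
    simpa using (((hasDerivAt_id t).mul_const (u ⬝ᵥ y)).const_add (u ⬝ᵥ torusRep x)).const_mul
      (2 * Real.pi)
  exact h.cos.congr_deriv (by ring)

theorem hasDerivAt_torusSin {u : Fin n → ℝ} (hu : IsIntegerVec u) (y : Fin n → ℝ)
    (x : UnitAddTorus (Fin n)) (t : ℝ) :
    HasDerivAt (fun t : ℝ => torusSin u (x + torusProj (t • y)))
      (2 * Real.pi * (u ⬝ᵥ y) * torusCos u (x + torusProj (t • y))) t := by
  simp only [torusCos_add_torusProj hu, torusSin_add_torusProj hu, dotProduct_smul, smul_eq_mul]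
  have h : HasDerivAt (fun t : ℝ => 2 * Real.pi * (u ⬝ᵥ torusRep x + t * (u ⬝ᵥ y)))
      (2 * Real.pi * (u ⬝ᵥ y)) t := by
    simpa using (((hasDerivAt_id t).mul_const (u ⬝ᵥ y)).const_add (u ⬝ᵥ torusRep x)).const_mul
      (2 * Real.pi)
  exact h.sin.congr_deriv (by ring)

end Torus

/-! ### The eigenfunctions and their Stein kernel -/

section Eigenfunctions

variable {n k : ℕ}

theorem trigSum_eq_sum (B : Matrix (Fin n) (Fin n) ℝ) (V : Finset (Fin n → ℝ))
    (a : EuclideanSpace ℝ V) (y : Fin n → ℝ) :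
    trigSum B V a y = ∑ v : V, a v * Real.cos (2 * Real.pi * ((B *ᵥ v) ⬝ᵥ y)) := by
  rw [trigSum, Complex.re_sum]
  refine Finset.sum_congr rfl fun v _ => ?_
  rw [Complex.re_ofReal_mul, bilinB, show (2 * (Real.pi : ℂ) * Complex.I *
    (((B *ᵥ v) ⬝ᵥ y : ℝ) : ℂ)) = ((2 * Real.pi * ((B *ᵥ v) ⬝ᵥ y) : ℝ) : ℂ) * Complex.I by
      push_cast; ring, Complex.exp_ofReal_mul_I_re]

theorem torusFun_eq_sum (B : Matrix (Fin n) (Fin n) ℝ) (V : Finset (Fin n → ℝ))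
    (a : EuclideanSpace ℝ V) (x : UnitAddTorus (Fin n)) :
    torusFun B V a x = ∑ v : V, a v * torusCos (B *ᵥ v) x :=
  trigSum_eq_sum B V a _

theorem bilinB_comm {B : Matrix (Fin n) (Fin n) ℝ} (hB : B.IsHermitian) (v w : Fin n → ℝ) :
    bilinB B v w = bilinB B w v := by
  have h : Bᵀ = B := by simpa using hB.eq
  rw [bilinB, bilinB, dotProduct_comm, Matrix.dotProduct_mulVec, ← Matrix.mulVec_transpose, h]

theorem fderiv_sum_mul_comp_apply {J E : Type*} [Fintype J] [NormedAddCommGroup E]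
    [NormedSpace ℝ E] (c : J → ℝ) (ℓ : J → E →L[ℝ] ℝ) {f f' : ℝ → ℝ}
    (hf : ∀ x, HasDerivAt f (f' x) x) (y e : E) :
    fderiv ℝ (fun z => ∑ j, c j * f (ℓ j z)) y e = ∑ j, c j * (f' (ℓ j y) * ℓ j e) := by
  have h : HasFDerivAt (fun z => ∑ j, c j * f (ℓ j z)) (∑ j, c j • (f' (ℓ j y) • ℓ j)) y :=
    HasFDerivAt.fun_sum fun j _ =>
      ((hf (ℓ j y)).comp_hasFDerivAt y (ℓ j).hasFDerivAt).const_mul (c j)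
  rw [h.fderiv]
  simp

/-- Each wave is an eigenfunction: its eigenvalue is minus the form B⁻¹ evaluated at 2πBv, which is
(2π)²‖v‖_B² = μ. -/
theorem flatLaplacian_torusFun {B : Matrix (Fin n) (Fin n) ℝ} (hB : B.PosDef)
    (V : Finset (Fin n → ℝ)) {μ : ℝ} (hint : ∀ v ∈ V, IsIntegerVec (B *ᵥ v))
    (hμ : ∀ v ∈ V, bilinB B v v = μ / (2 * Real.pi) ^ 2) (a : EuclideanSpace ℝ V)
    (y : Fin n → ℝ) :
    flatLaplacian B (fun z => torusFun B V a (torusProj z)) y =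
      -μ * torusFun B V a (torusProj y) := by
  let ℓ : V → (Fin n → ℝ) →L[ℝ] ℝ := fun v => LinearMap.toContinuousLinearMap
    { toFun := fun z => 2 * Real.pi * ((B *ᵥ v) ⬝ᵥ z)
      map_add' := fun z w => by rw [dotProduct_add, mul_add]
      map_smul' := fun t z => by
        simp only [dotProduct_smul, smul_eq_mul, RingHom.id_apply]
        ring }
  have hℓ : ∀ v z, ℓ v z = 2 * Real.pi * ((B *ᵥ v) ⬝ᵥ z) := fun _ _ => rfl
  have e0 : (fun z => torusFun B V a (torusProj z)) = fun z => ∑ v : V, a v * Real.cos (ℓ v z) :=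
    funext fun z => by rw [torusFun_torusProj B V hint, trigSum_eq_sum]; rfl
  have e1 : ∀ l, (fun z => fderiv ℝ (fun z => ∑ v : V, a v * Real.cos (ℓ v z)) z
      (Pi.single l 1)) = fun z => ∑ v : V, (a v * ℓ v (Pi.single l 1)) * -Real.sin (ℓ v z) :=
    fun l => funext fun z => by
      rw [fderiv_sum_mul_comp_apply _ _ Real.hasDerivAt_cos]
      exact Finset.sum_congr rfl fun v _ => by ring
  have hdet : IsUnit B.det := hB.det_pos.ne'.isUnit
  have hq : ∀ v : V, ∑ j, ∑ l, B⁻¹ j l * (ℓ v (Pi.single l 1) * ℓ v (Pi.single j 1)) = μ := by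
    intro v
    have h1 : bilinB B v v = ∑ j, ∑ l, B⁻¹ j l * ((B *ᵥ v) l * (B *ᵥ v) j) := by
      have h2 : (v : Fin n → ℝ) = B⁻¹ *ᵥ (B *ᵥ v) := by
        rw [Matrix.mulVec_mulVec, Matrix.nonsing_inv_mul B hdet, Matrix.one_mulVec]
      have h4 : ∀ b : Fin n → ℝ, b ⬝ᵥ (B⁻¹ *ᵥ b) = ∑ j, ∑ l, B⁻¹ j l * (b l * b j) := fun b => by
        simp only [dotProduct, Matrix.mulVec, Finset.mul_sum]
        exact Finset.sum_congr rfl fun j _ => Finset.sum_congr rfl fun l _ => by ring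
      rw [← h4, ← h2, bilinB]
    have h3 : μ = (2 * Real.pi) ^ 2 * bilinB B v v := by
      rw [hμ v v.2]
      field_simp
    rw [h3, h1]
    simp only [hℓ, dotProduct_single, mul_one, Finset.mul_sum]
    refine Finset.sum_congr rfl fun j _ => Finset.sum_congr rfl fun l _ => ?_
    ring
  rw [flatLaplacian, e0]
  simp only [e1]
  have hs : ∀ x, HasDerivAt (fun x => -Real.sin x) (-Real.cos x) x :=
    fun x => (Real.hasDerivAt_sin x).neg
  simp only [fderiv_sum_mul_comp_apply _ _ hs]
  rw [congrFun e0 y]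
  simp only [Finset.mul_sum]
  calc _ = ∑ v : V, ∑ j, ∑ l, B⁻¹ j l * (a v * ℓ v (Pi.single l 1) *
        (-Real.cos (ℓ v y) * ℓ v (Pi.single j 1))) := by
        symm
        rw [Finset.sum_comm]
        exact Finset.sum_congr rfl fun j _ => Finset.sum_comm
    _ = _ := by
      refine Finset.sum_congr rfl fun v _ => ?_
      calc _ = -(a v * Real.cos (ℓ v y)) *
            ∑ j, ∑ l, B⁻¹ j l * (ℓ v (Pi.single l 1) * ℓ v (Pi.single j 1)) := by
            simp only [Finset.mul_sum]
            exact Finset.sum_congr rfl fun j _ => Finset.sum_congr rfl fun l _ => by ring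
        _ = _ := by rw [hq]; ring

/-- A product of two cosines has frequencies B(v + w) and B(v - w). As B is injective, the first is
never 0, and the second is 0 only for v = w. -/
theorem integral_torusFun_mul_torusFun {B : Matrix (Fin n) (Fin n) ℝ} (hB : B.PosDef)
    {V W : Finset (Fin n → ℝ)} (hV : ∀ v ∈ V, IsIntegerVec (B *ᵥ v))
    (hW : ∀ w ∈ W, IsIntegerVec (B *ᵥ w)) (hneg : ∀ v ∈ V, ∀ w ∈ W, v + w ≠ 0)
    (a : EuclideanSpace ℝ V) (b : EuclideanSpace ℝ W) :
    ∫ x, torusFun B V a x * torusFun B W b x =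
      ∑ v : V, ∑ w : W, a v * b w * if (v : Fin n → ℝ) = w then 1 / 2 else 0 := by
  have hinj : Function.Injective (fun v => B *ᵥ v) :=
    Matrix.mulVec_injective_iff_isUnit.2 ((Matrix.isUnit_iff_isUnit_det B).2 hB.det_pos.ne'.isUnit)
  have hi : ∀ (v : V) (w : W), Integrable fun x =>
      a v * b w * (torusCos (B *ᵥ v) x * torusCos (B *ᵥ w) x) := fun v w => by
    simp only [torusCos_mul_torusCos]
    exact (((integrable_torusCos _).add (integrable_torusCos _)).div_const 2).const_mul _
  have e : ∀ x, torusFun B V a x * torusFun B W b x = ∑ v : V, ∑ w : W,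
      a v * b w * (torusCos (B *ᵥ v) x * torusCos (B *ᵥ w) x) := fun x => by
    rw [torusFun_eq_sum, torusFun_eq_sum, Finset.sum_mul_sum]
    exact Finset.sum_congr rfl fun v _ => Finset.sum_congr rfl fun w _ => by ring
  simp only [e]
  rw [integral_finsetSum _ fun v _ => integrable_finsetSum _ fun w _ => hi v w]
  refine Finset.sum_congr rfl fun v _ => ?_
  rw [integral_finsetSum _ fun w _ => hi v w]
  refine Finset.sum_congr rfl fun w _ => ?_
  have h0 : B *ᵥ v + B *ᵥ w ≠ 0 := fun h => hneg v v.2 w w.2 <| hinj <| by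
    simpa [Matrix.mulVec_add] using h
  rw [integral_const_mul, integral_torusCos_mul_torusCos (hV v v.2) (hW w w.2) h0]
  simp only [hinj.eq_iff]

/-- The random vector `(f_1, …, f_k)` on the torus with coefficients `α`. -/
noncomputable def torusVec (B : Matrix (Fin n) (Fin n) ℝ) (V : Fin k → Finset (Fin n → ℝ))
    (α : (r : Fin k) → EuclideanSpace ℝ (V r)) (x : UnitAddTorus (Fin n)) :
    EuclideanSpace ℝ (Fin k) :=
  WithLp.toLp 2 fun r => torusFun B (V r) (α r) x

/-- The Stein kernel of `torusVec`: the matrix `⟨∇f_r, ∇f_s⟩_{B⁻¹} / μ_r`. -/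
noncomputable def torusKernel (B : Matrix (Fin n) (Fin n) ℝ) (V : Fin k → Finset (Fin n → ℝ))
    (m : Fin k → ℝ) (α : (r : Fin k) → EuclideanSpace ℝ (V r)) (x : UnitAddTorus (Fin n)) :
    Matrix (Fin k) (Fin k) ℝ :=
  Matrix.of fun r s => ∑ v : V r, ∑ w : V s,
    α r v * α s w * ((m r)⁻¹ * bilinB B v w * torusSin (B *ᵥ v) x * torusSin (B *ᵥ w) x)

theorem measurable_torusFun (B : Matrix (Fin n) (Fin n) ℝ) (V : Finset (Fin n → ℝ))
    (a : EuclideanSpace ℝ V) : Measurable (torusFun B V a) := by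
  rw [funext (torusFun_eq_sum B V a)]
  fun_prop

theorem measurable_torusVec (B : Matrix (Fin n) (Fin n) ℝ) (V : Fin k → Finset (Fin n → ℝ))
    (α : (r : Fin k) → EuclideanSpace ℝ (V r)) : Measurable (torusVec B V α) :=
  (PiLp.continuous_toLp 2 _).measurable.comp
    (measurable_pi_lambda _ fun r => measurable_torusFun B (V r) (α r))

theorem norm_torusVec_le (B : Matrix (Fin n) (Fin n) ℝ) (V : Fin k → Finset (Fin n → ℝ))
    (α : (r : Fin k) → EuclideanSpace ℝ (V r)) (x : UnitAddTorus (Fin n)) :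
    ‖torusVec B V α x‖ ≤ ∑ r, ∑ v : V r, |α r v| := by
  rw [← (EuclideanSpace.basisFun (Fin k) ℝ).sum_repr (torusVec B V α x)]
  refine (norm_sum_le _ _).trans (Finset.sum_le_sum fun r _ => ?_)
  rw [norm_smul]
  simp only [EuclideanSpace.basisFun_repr, EuclideanSpace.basisFun_apply,
    PiLp.norm_single, norm_one, mul_one, torusVec, torusFun_eq_sum]
  refine (norm_sum_le _ _).trans (Finset.sum_le_sum fun v _ => ?_)
  rw [norm_mul]
  exact mul_le_of_le_one_right (norm_nonneg _) (abs_torusCos_le_one _ x)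

/-- Integration by parts is carried out one frequency at a time. Along the direction v the
derivative of sin(2π⟨Bv, x⟩) is 2πm_r cos(2π⟨Bv, x⟩), because ⟨Bv, v⟩ = m_r. Hence the total
derivative along v of sin(2π⟨Bv, x⟩) φ(F) integrates to 0, which expresses the integral of
cos(2π⟨Bv, x⟩) φ(F) through integrals with sin sin ∂_s φ(F). Weighting by the coefficients a_v and
summing gives the kernel. -/
theorem isSteinKernel_torusVec {B : Matrix (Fin n) (Fin n) ℝ} (hB : B.PosDef)
    {V : Fin k → Finset (Fin n → ℝ)} {m : Fin k → ℝ}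
    (hint : ∀ r, ∀ v ∈ V r, IsIntegerVec (B *ᵥ v)) (hm : ∀ r, m r ≠ 0)
    (hmV : ∀ r, ∀ v ∈ V r, bilinB B v v = m r) (α : (r : Fin k) → EuclideanSpace ℝ (V r)) :
    IsSteinKernel volume (torusVec B V α) (torusKernel B V m α) := by
  have habs : ∀ v (x : UnitAddTorus (Fin n)), |torusSin v x| ≤ 1 := abs_torusSin_le_one
  obtain ⟨KF, hKF⟩ : ∃ K, ∀ x, ‖torusVec B V α x‖ ≤ K := ⟨_, norm_torusVec_le B V α⟩
  refine ⟨measurable_torusVec B V α, fun r s => ?_, ⟨KF, hKF⟩, ?_, ?_⟩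
  · simp only [torusKernel, Matrix.of_apply]
    fun_prop
  · refine ⟨∑ r, ∑ s, ∑ v : V r, ∑ w : V s, |α r v * α s w * ((m r)⁻¹ * bilinB B v w)|,
      fun x r s => ?_⟩
    have h1 : |torusKernel B V m α x r s| ≤
        ∑ v : V r, ∑ w : V s, |α r v * α s w * ((m r)⁻¹ * bilinB B v w)| := by
      simp only [torusKernel, Matrix.of_apply]
      refine (Finset.abs_sum_le_sum_abs _ _).trans (Finset.sum_le_sum fun v _ =>
        (Finset.abs_sum_le_sum_abs _ _).trans (Finset.sum_le_sum fun w _ => ?_))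
      rw [← mul_assoc, ← mul_assoc, abs_mul, abs_mul]
      exact (mul_le_of_le_one_right (by positivity) (habs _ x)).trans
        (mul_le_of_le_one_right (by positivity) (habs _ x))
    have h2 : ∀ r s, 0 ≤ ∑ v : V r, ∑ w : V s, |α r v * α s w * ((m r)⁻¹ * bilinB B v w)| :=
      fun r s => Finset.sum_nonneg fun v _ => Finset.sum_nonneg fun w _ => abs_nonneg _
    refine h1.trans ((Finset.single_le_sum (f := fun s => ∑ v : V r, ∑ w : V s,
      |α r v * α s w * ((m r)⁻¹ * bilinB B v w)|) (fun s _ => h2 r s) (Finset.mem_univ s)).trans ?_)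
    exact Finset.single_le_sum (f := fun r => ∑ s, ∑ v : V r, ∑ w : V s,
      |α r v * α s w * ((m r)⁻¹ * bilinB B v w)|)
      (fun r _ => Finset.sum_nonneg fun s _ => h2 r s) (Finset.mem_univ r)
  · rintro r φ hφ ⟨C, hC⟩
    have hd : Differentiable ℝ φ := hφ.differentiable one_ne_zero
    have hFm := measurable_torusVec B V α
    have hφF : Measurable fun x => φ (torusVec B V α x) := hφ.continuous.measurable.comp hFm
    have hdF : ∀ s : Fin k,
        Measurable fun x => fderiv ℝ φ (torusVec B V α x) (EuclideanSpace.single s 1) := fun s =>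
      ((hφ.continuous_fderiv one_ne_zero).clm_apply continuous_const).measurable.comp hFm
    have hds : ∀ z (s : Fin k), |fderiv ℝ φ z (EuclideanSpace.single s 1)| ≤ C := fun z s => by
      simpa using (fderiv ℝ φ z).le_of_opNorm_le (hC z) (EuclideanSpace.single s 1)
    have hC0 : 0 ≤ C := (norm_nonneg _).trans (hC 0)
    -- The test function may be unbounded, but F takes its values in a compact ball.
    obtain ⟨K, hK⟩ := (isCompact_closedBall (0 : EuclideanSpace ℝ (Fin k))
      KF).exists_bound_of_continuousOn hφ.continuous.continuousOn
    have hKφ : ∀ x, |φ (torusVec B V α x)| ≤ K := fun x => hK _ (by simp [hKF x])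
    have hK0 : 0 ≤ K := (abs_nonneg _).trans (hKφ 0)
    -- the directional derivative of a component
    let G : (Fin n → ℝ) → Fin k → UnitAddTorus (Fin n) → ℝ := fun v s x =>
      ∑ w : V s, α s w * (-(2 * Real.pi * bilinB B w v) * torusSin (B *ᵥ w) x)
    have hGm : ∀ v s, Measurable (G v s) := fun v s => by fun_prop
    have hGb : ∀ v s x, |G v s x| ≤ ∑ w : V s, |α s w * -(2 * Real.pi * bilinB B w v)| := by
      intro v s x
      refine (Finset.abs_sum_le_sum_abs _ _).trans (Finset.sum_le_sum fun w _ => ?_)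
      rw [← mul_assoc, abs_mul]
      exact mul_le_of_le_one_right (abs_nonneg _) (habs _ x)
    have hsum : torusVec B V α = fun x => ∑ s, torusFun B (V s) (α s) x •
        (EuclideanSpace.single s 1 : EuclideanSpace ℝ (Fin k)) := funext fun x => by
      rw [← (EuclideanSpace.basisFun (Fin k) ℝ).sum_repr (torusVec B V α x)]
      simp [torusVec]
    have hFder : ∀ v x t, HasDerivAt (fun t : ℝ => torusVec B V α (x + torusProj (t • v)))
        (∑ s, G v s (x + torusProj (t • v)) •
          (EuclideanSpace.single s 1 : EuclideanSpace ℝ (Fin k))) t := by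
      intro v x t
      rw [hsum]
      refine HasDerivAt.fun_sum fun s _ => HasDerivAt.smul_const ?_ _
      rw [funext (torusFun_eq_sum B (V s) (α s))]
      exact HasDerivAt.fun_sum fun w _ =>
        (hasDerivAt_torusCos (hint s w w.2) v x t).const_mul (α s w)
    have icos : ∀ v, Integrable fun x => torusCos v x * φ (torusVec B V α x) := fun v =>
      (integrable_const K).mono' (by fun_prop) (Filter.Eventually.of_forall fun x => by
        rw [norm_mul]
        exact (mul_le_of_le_one_left (norm_nonneg _) (abs_torusCos_le_one v x)).trans (hKφ x))
    have isin : ∀ (v w : Fin n → ℝ) (s : Fin k), Integrable fun x => torusSin v x * torusSin w x *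
        fderiv ℝ φ (torusVec B V α x) (EuclideanSpace.single s 1) := fun v w s => by
      have := hdF s
      refine (integrable_const C).mono' (by fun_prop) (Filter.Eventually.of_forall fun x => ?_)
      rw [norm_mul, norm_mul]
      exact (mul_le_of_le_one_left (norm_nonneg _)
        (mul_le_one₀ (habs v x) (norm_nonneg _) (habs w x))).trans (hds _ s)
    have key : ∀ v : V r, m r * ∫ x, torusCos (B *ᵥ v) x * φ (torusVec B V α x) =
        ∑ s, ∑ w : V s, α s w * bilinB B v w * ∫ x, torusSin (B *ᵥ v) x * torusSin (B *ᵥ w) x *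
          fderiv ℝ φ (torusVec B V α x) (EuclideanSpace.single s 1) := by
      intro v
      have hibp := integral_eq_zero_of_hasDerivAt_torus (v : Fin n → ℝ)
        (H := fun x => torusSin (B *ᵥ v) x * φ (torusVec B V α x))
        (H' := fun x => 2 * Real.pi * m r * torusCos (B *ᵥ v) x * φ (torusVec B V α x) +
          torusSin (B *ᵥ v) x * ∑ s, G v s x *
            fderiv ℝ φ (torusVec B V α x) (EuclideanSpace.single s 1))
        (K := K) (C := |2 * Real.pi * m r| * K +
          ∑ s, (∑ w : V s, |α s w * -(2 * Real.pi * bilinB B w v)|) * C)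
        ((measurable_torusSin _).mul hφF)
        ((((measurable_torusCos _).const_mul _).mul hφF).add ((measurable_torusSin _).mul
          (Finset.measurable_sum _ fun s _ => (hGm v s).mul (hdF s)))) (fun x => ?_) (fun x => ?_) (fun x t => ?_)
      · have e : ∀ x, 2 * Real.pi * m r * torusCos (B *ᵥ v) x * φ (torusVec B V α x) +
            torusSin (B *ᵥ v) x * ∑ s, G v s x *
              fderiv ℝ φ (torusVec B V α x) (EuclideanSpace.single s 1) =
            2 * Real.pi * m r * (torusCos (B *ᵥ v) x * φ (torusVec B V α x)) -
            ∑ s, ∑ w : V s, 2 * Real.pi * (α s w * bilinB B v w) *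
              (torusSin (B *ᵥ v) x * torusSin (B *ᵥ w) x *
                fderiv ℝ φ (torusVec B V α x) (EuclideanSpace.single s 1)) := fun x => by
          rw [sub_eq_add_neg, ← Finset.sum_neg_distrib, Finset.mul_sum, mul_assoc _ (torusCos _ _)]
          congr 1
          refine Finset.sum_congr rfl fun s _ => ?_
          simp only [G, Finset.sum_mul, Finset.mul_sum, ← Finset.sum_neg_distrib]
          refine Finset.sum_congr rfl fun w _ => ?_
          rw [bilinB_comm hB.isHermitian w v]
          ring
        simp only [e] at hibp
        rw [integral_sub ((icos _).const_mul _) (integrable_finsetSum _ fun s _ =>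
          integrable_finsetSum _ fun w _ => (isin _ _ _).const_mul _), integral_const_mul,
          integral_finsetSum _ fun s _ => integrable_finsetSum _ fun w _ =>
            (isin _ _ _).const_mul _] at hibp
        have e2 : ∀ s, ∫ x, ∑ w : V s, 2 * Real.pi * (α s w * bilinB B v w) *
            (torusSin (B *ᵥ v) x * torusSin (B *ᵥ w) x *
              fderiv ℝ φ (torusVec B V α x) (EuclideanSpace.single s 1)) =
            2 * Real.pi * ∑ w : V s, α s w * bilinB B v w * ∫ x, torusSin (B *ᵥ v) x *
              torusSin (B *ᵥ w) x *
              fderiv ℝ φ (torusVec B V α x) (EuclideanSpace.single s 1) := fun s => by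
          rw [integral_finsetSum _ fun w _ => (isin _ _ _).const_mul _, Finset.mul_sum]
          refine Finset.sum_congr rfl fun w _ => ?_
          rw [integral_const_mul, mul_assoc]
        simp only [e2, ← Finset.mul_sum] at hibp
        have hpi : 2 * Real.pi ≠ 0 := by positivity
        refine mul_left_cancel₀ hpi ?_
        linarith
      · rw [abs_mul]
        exact (mul_le_of_le_one_left (abs_nonneg _) (habs _ x)).trans (hKφ x)
      · refine (abs_add_le _ _).trans (add_le_add ?_ ?_)
        · rw [mul_assoc, abs_mul, abs_mul (torusCos _ _)]
          gcongr
          exact (mul_le_of_le_one_left (abs_nonneg _) (abs_torusCos_le_one _ x)).trans (hKφ x)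
        · rw [abs_mul]
          refine (mul_le_of_le_one_left (abs_nonneg _) (habs _ x)).trans
            ((Finset.abs_sum_le_sum_abs _ _).trans (Finset.sum_le_sum fun s _ => ?_))
          rw [abs_mul]
          exact mul_le_mul (hGb v s x) (hds _ s) (abs_nonneg _)
            (Finset.sum_nonneg fun _ _ => abs_nonneg _)
      · have h1 := hasDerivAt_torusSin (hint r v v.2) (v : Fin n → ℝ) x t
        have h2 := (hd (torusVec B V α (x + torusProj (t • (v : Fin n → ℝ))))).hasFDerivAt
          |>.comp_hasDerivAt t (hFder v x t)
        refine (h1.mul h2).congr_deriv ?_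
        rw [← hmV r v v.2, map_sum]
        simp only [map_smul, smul_eq_mul, Function.comp, bilinB]
    have eL : ∀ x, torusVec B V α x r * φ (torusVec B V α x) =
        ∑ v : V r, α r v * (torusCos (B *ᵥ v) x * φ (torusVec B V α x)) := fun x => by
      rw [show torusVec B V α x r = torusFun B (V r) (α r) x from rfl, torusFun_eq_sum,
        Finset.sum_mul]
      exact Finset.sum_congr rfl fun v _ => by ring
    have eR : ∀ x, ∑ s, torusKernel B V m α x r s *
        fderiv ℝ φ (torusVec B V α x) (EuclideanSpace.single s 1) =
        ∑ v : V r, ∑ s, ∑ w : V s, α r v * (m r)⁻¹ * (α s w * bilinB B v w) *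
          (torusSin (B *ᵥ v) x * torusSin (B *ᵥ w) x *
            fderiv ℝ φ (torusVec B V α x) (EuclideanSpace.single s 1)) := fun x => by
      rw [Finset.sum_comm]
      refine Finset.sum_congr rfl fun s _ => ?_
      simp only [torusKernel, Matrix.of_apply, Finset.sum_mul]
      refine Finset.sum_congr rfl fun v _ => Finset.sum_congr rfl fun w _ => ?_
      ring
    simp only [eL, eR]
    rw [integral_finsetSum _ fun v _ => (icos _).const_mul _,
      integral_finsetSum _ fun v _ => integrable_finsetSum _ fun s _ =>
        integrable_finsetSum _ fun w _ => (isin _ _ _).const_mul _]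
    refine Finset.sum_congr rfl fun v _ => ?_
    rw [integral_const_mul, integral_finsetSum _ fun s _ => integrable_finsetSum _ fun w _ =>
      (isin _ _ _).const_mul _]
    have e3 : ∀ s, ∫ x, ∑ w : V s, α r v * (m r)⁻¹ * (α s w * bilinB B v w) *
        (torusSin (B *ᵥ v) x * torusSin (B *ᵥ w) x *
          fderiv ℝ φ (torusVec B V α x) (EuclideanSpace.single s 1)) =
        α r v * (m r)⁻¹ * ∑ w : V s, α s w * bilinB B v w * ∫ x, torusSin (B *ᵥ v) x *
          torusSin (B *ᵥ w) x *
          fderiv ℝ φ (torusVec B V α x) (EuclideanSpace.single s 1) := fun s => by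
      rw [integral_finsetSum _ fun w _ => (isin _ _ _).const_mul _, Finset.mul_sum]
      refine Finset.sum_congr rfl fun w _ => ?_
      rw [integral_const_mul, mul_assoc]
    simp only [e3, ← Finset.mul_sum]
    rw [← key v, mul_assoc, inv_mul_cancel_left₀ (hm r)]

end Eigenfunctions

/-! ### Second moments of bilinear and quadratic forms in the coefficients -/

section QuadraticForms

variable {Ω : Type*} [MeasurableSpace Ω] {P : Measure Ω} {ι κ : Type*} [Fintype ι] [Fintype κ]

theorem integral_comp_of_hasLaw_uniformSphere {ρ : ℝ} {a : Ω → EuclideanSpace ℝ ι}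
    (ha : HasLaw a (uniformSphere ι ρ) P) {f : EuclideanSpace ℝ ι → ℝ} (hf : Continuous f) :
    ∫ ω, f (a ω) ∂P = ∫ u, f u ∂(uniformSphere ι ρ) := by
  rw [← ha.map_eq, integral_map ha.aemeasurable hf.aestronglyMeasurable]

variable [Nonempty ι] [Nonempty κ]

theorem integrable_comp_of_hasLaw_uniformSphere {ρ : ℝ} (hρ : 0 ≤ ρ)
    {a : Ω → EuclideanSpace ℝ ι} (ha : HasLaw a (uniformSphere ι ρ) P)
    {f : EuclideanSpace ℝ ι → ℝ} (hf : Continuous f) : Integrable (fun ω => f (a ω)) P := by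
  have h := integrable_uniformSphere hρ hf
  rw [← ha.map_eq] at h
  exact h.comp_aemeasurable ha.aemeasurable

/-- By independence the expectation of each term of the expanded square factors into two second
moments, and only the terms with v = v' and w = w' survive. -/
theorem integral_sq_bilinear_uniformSphere {ρ : ℝ} (hρ : 0 ≤ ρ)
    {a : Ω → EuclideanSpace ℝ ι} (ha : HasLaw a (uniformSphere ι ρ) P)
    {b : Ω → EuclideanSpace ℝ κ} (hb : HasLaw b (uniformSphere κ ρ) P) (hab : IndepFun a b P)
    (M : ι → κ → ℝ) :
    ∫ ω, (∑ v, ∑ w, a ω v * b ω w * M v w) ^ 2 ∂P =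
      ρ ^ 4 / (Fintype.card ι * Fintype.card κ) * ∑ v, ∑ w, M v w ^ 2 := by
  classical
  have e : ∀ ω, (∑ v, ∑ w, a ω v * b ω w * M v w) ^ 2 = ∑ v, ∑ v', ∑ w, ∑ w',
      M v w * M v' w' * ((a ω v * a ω v') * (b ω w * b ω w')) := fun ω => by
    rw [sq, Finset.sum_mul_sum]
    refine Finset.sum_congr rfl fun v _ => Finset.sum_congr rfl fun v' _ => ?_
    rw [Finset.sum_mul_sum]
    exact Finset.sum_congr rfl fun w _ => Finset.sum_congr rfl fun w' _ => by ring
  have hca : ∀ v v', Continuous fun u : EuclideanSpace ℝ ι => u v * u v' := fun v v' => by fun_prop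
  have hcb : ∀ v v', Continuous fun u : EuclideanSpace ℝ κ => u v * u v' := fun v v' => by fun_prop
  have hind : ∀ v v' w w', IndepFun (fun ω => a ω v * a ω v') (fun ω => b ω w * b ω w') P :=
    fun v v' w w' => hab.comp (hca v v').measurable (hcb w w').measurable
  have hi : ∀ v v' w w', Integrable (fun ω => M v w * M v' w' *
      ((a ω v * a ω v') * (b ω w * b ω w'))) P := fun v v' w w' =>
    ((hind v v' w w').integrable_mul (integrable_comp_of_hasLaw_uniformSphere hρ ha (hca v v'))
      (integrable_comp_of_hasLaw_uniformSphere hρ hb (hcb w w'))).const_mul _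
  have hI : ∀ v v' w w', ∫ ω, M v w * M v' w' * ((a ω v * a ω v') * (b ω w * b ω w')) ∂P =
      M v w * M v' w' * ((ρ ^ 2 / Fintype.card ι * if v = v' then 1 else 0) *
        (ρ ^ 2 / Fintype.card κ * if w = w' then 1 else 0)) := fun v v' w w' => by
    rw [integral_const_mul, (hind v v' w w').integral_fun_mul_eq_mul_integral
      (integrable_comp_of_hasLaw_uniformSphere hρ ha (hca v v')).aestronglyMeasurable
      (integrable_comp_of_hasLaw_uniformSphere hρ hb (hcb w w')).aestronglyMeasurable,
      integral_comp_of_hasLaw_uniformSphere ha (hca v v'),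
      integral_comp_of_hasLaw_uniformSphere hb (hcb w w'),
      integral_coord_mul_coord_uniformSphere hρ, integral_coord_mul_coord_uniformSphere hρ]
  simp only [e]
  rw [integral_finsetSum _ fun v _ => integrable_finsetSum _ fun v' _ =>
    integrable_finsetSum _ fun w _ => integrable_finsetSum _ fun w' _ => hi v v' w w',
    Finset.mul_sum]
  refine Finset.sum_congr rfl fun v _ => ?_
  rw [integral_finsetSum _ fun v' _ => integrable_finsetSum _ fun w _ =>
    integrable_finsetSum _ fun w' _ => hi v v' w w']
  have h1 : ∀ v', ∫ ω, ∑ w, ∑ w', M v w * M v' w' * ((a ω v * a ω v') * (b ω w * b ω w')) ∂P =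
      ∑ w, ∑ w', ∫ ω, M v w * M v' w' * ((a ω v * a ω v') * (b ω w * b ω w')) ∂P := fun v' => by
    rw [integral_finsetSum _ fun w _ => integrable_finsetSum _ fun w' _ => hi v v' w w']
    exact Finset.sum_congr rfl fun w _ => integral_finsetSum _ fun w' _ => hi v v' w w'
  simp only [h1, hI]
  simp only [mul_ite, ite_mul, mul_one, mul_zero, zero_mul, Finset.sum_ite_eq, Finset.sum_ite_irrel,
    Finset.sum_const_zero, Finset.mem_univ, if_true, Finset.mul_sum]
  refine Finset.sum_congr rfl fun w _ => ?_
  field_simp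

/-- Of the three pairings in the fourth moment, one produces the square of the trace of M and the
other two each produce ∑ M_{vw}². -/
theorem integral_sq_quadratic_sub_one_uniformSphere {ρ : ℝ} (hρ : 0 ≤ ρ)
    {a : Ω → EuclideanSpace ℝ ι} (ha : HasLaw a (uniformSphere ι ρ) P)
    (M : ι → ι → ℝ) (hM : ∀ v w, M v w = M w v) :
    ∫ ω, ((∑ v, ∑ w, a ω v * a ω w * M v w) - 1) ^ 2 ∂P =
      ρ ^ 4 / (Fintype.card ι * (Fintype.card ι + 2)) *
        ((∑ v, ∑ w, M v v * M w w) + 2 * ∑ v, ∑ w, M v w ^ 2) -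
      2 * (ρ ^ 2 / Fintype.card ι * ∑ v, M v v) + 1 := by
  classical
  have hint : ∀ f : EuclideanSpace ℝ ι → ℝ, Continuous f → Integrable f (uniformSphere ι ρ) :=
    fun f hf => integrable_uniformSphere hρ hf
  rw [integral_comp_of_hasLaw_uniformSphere ha
    (f := fun u => ((∑ v, ∑ w, u v * u w * M v w) - 1) ^ 2) (by fun_prop)]
  have e : ∀ u : EuclideanSpace ℝ ι, ((∑ v, ∑ w, u v * u w * M v w) - 1) ^ 2 =
      (∑ v, ∑ v', ∑ w, ∑ w', M v w * M v' w' * (u v * u v' * u w * u w')) -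
        (∑ v, ∑ w, 2 * M v w * (u v * u w)) - (-1) := fun u => by
    have h1 : (∑ v, ∑ w, u v * u w * M v w) ^ 2 =
        ∑ v, ∑ v', ∑ w, ∑ w', M v w * M v' w' * (u v * u v' * u w * u w') := by
      rw [sq, Finset.sum_mul_sum]
      refine Finset.sum_congr rfl fun v _ => Finset.sum_congr rfl fun v' _ => ?_
      rw [Finset.sum_mul_sum]
      exact Finset.sum_congr rfl fun w _ => Finset.sum_congr rfl fun w' _ => by ring
    have h2 : ∑ v, ∑ w, 2 * M v w * (u v * u w) = 2 * ∑ v, ∑ w, u v * u w * M v w := by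
      simp only [Finset.mul_sum]
      exact Finset.sum_congr rfl fun v _ => Finset.sum_congr rfl fun w _ => by ring
    rw [← h1, h2]
    ring
  simp only [e]
  rw [integral_sub_sub (hint _ (by fun_prop)) (hint _ (by fun_prop)) (integrable_const _)]
  have h1 : ∫ u : EuclideanSpace ℝ ι, ∑ v, ∑ w, 2 * M v w * (u v * u w) ∂(uniformSphere ι ρ) =
      2 * (ρ ^ 2 / Fintype.card ι * ∑ v, M v v) := by
    rw [integral_finsetSum _ fun v _ => hint _ (by fun_prop)]
    simp only [Finset.mul_sum]
    refine Finset.sum_congr rfl fun v _ => ?_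
    rw [integral_finsetSum _ fun w _ => hint _ (by fun_prop)]
    simp only [integral_const_mul, integral_coord_mul_coord_uniformSphere hρ]
    simp only [mul_ite, mul_one, mul_zero, Finset.sum_ite_eq, Finset.mem_univ, if_true]
    ring
  have h2 : ∫ u : EuclideanSpace ℝ ι, ∑ v, ∑ v', ∑ w, ∑ w',
      M v w * M v' w' * (u v * u v' * u w * u w') ∂(uniformSphere ι ρ) =
      ρ ^ 4 / (Fintype.card ι * (Fintype.card ι + 2)) *
        ((∑ v, ∑ w, M v v * M w w) + 2 * ∑ v, ∑ w, M v w ^ 2) := by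
    have h3 : ∀ v v' w w', ∫ u : EuclideanSpace ℝ ι,
        M v w * M v' w' * (u v * u v' * u w * u w') ∂(uniformSphere ι ρ) =
        ρ ^ 4 / (Fintype.card ι * (Fintype.card ι + 2)) * (M v w * M v' w' *
        ((if v = v' then 1 else 0) * (if w = w' then 1 else 0) +
          (if v = w then 1 else 0) * (if v' = w' then 1 else 0) +
          (if v = w' then 1 else 0) * (if v' = w then 1 else 0))) := fun v v' w w' => by
      rw [integral_const_mul, integral_coord_four_uniformSphere hρ]
      ring
    have h4 : ∫ u : EuclideanSpace ℝ ι, ∑ v, ∑ v', ∑ w, ∑ w',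
        M v w * M v' w' * (u v * u v' * u w * u w') ∂(uniformSphere ι ρ) =
        ∑ v, ∑ v', ∑ w, ∑ w', ∫ u : EuclideanSpace ℝ ι,
          M v w * M v' w' * (u v * u v' * u w * u w') ∂(uniformSphere ι ρ) := by
      rw [integral_finsetSum _ fun v _ => hint _ (by fun_prop)]
      refine Finset.sum_congr rfl fun v _ => ?_
      rw [integral_finsetSum _ fun v' _ => hint _ (by fun_prop)]
      refine Finset.sum_congr rfl fun v' _ => ?_
      rw [integral_finsetSum _ fun w _ => hint _ (by fun_prop)]
      refine Finset.sum_congr rfl fun w _ => ?_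
      rw [integral_finsetSum _ fun w' _ => hint _ (by fun_prop)]
    rw [h4]
    simp only [h3, ← Finset.mul_sum]
    congr 1
    simp only [mul_add, Finset.sum_add_distrib, mul_ite, mul_one, mul_zero, Finset.sum_ite_eq,
      Finset.sum_ite_irrel, Finset.sum_const_zero,
      Finset.mem_univ, if_true]
    -- The crossed pairing is where the symmetry of M is needed.
    have h5 : ∑ v, ∑ w, M v w * M w v = ∑ v, ∑ w, M v w ^ 2 :=
      Finset.sum_congr rfl fun v _ => Finset.sum_congr rfl fun w _ => by rw [hM w v, sq]
    simp only [← sq, h5, ← Finset.mul_sum]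
    ring
  rw [h1, h2]
  simp

end QuadraticForms

/-! ### Mean square of the entries of the Stein kernel minus the identity -/

section SecondMoment

variable {n k : ℕ} {Ω : Type*} [MeasurableSpace Ω] {P : Measure Ω}
  {B : Matrix (Fin n) (Fin n) ℝ} {V : Fin k → Finset (Fin n → ℝ)} {m : Fin k → ℝ}
  {a : (r : Fin k) → Ω → EuclideanSpace ℝ (V r)}

theorem ae_norm_of_hasLaw_uniformSphere {ι : Type*} [Fintype ι] {ρ : ℝ} (hρ : 0 ≤ ρ)
    {b : Ω → EuclideanSpace ℝ ι} (hb : HasLaw b (uniformSphere ι ρ) P) : ∀ᵐ ω ∂P, ‖b ω‖ = ρ := by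
  have h := ae_norm_uniformSphere (ι := ι) hρ
  rw [← hb.map_eq] at h
  exact ae_of_ae_map hb.aemeasurable h

theorem torusKernel_sub_one_of_ne (α : (r : Fin k) → EuclideanSpace ℝ (V r))
    (x : UnitAddTorus (Fin n)) {r s : Fin k} (hrs : r ≠ s) :
    (torusKernel B V m α x - 1) r s = ∑ v : V r, ∑ w : V s,
      α r v * α s w * ((m r)⁻¹ * bilinB B v w * torusSin (B *ᵥ v) x * torusSin (B *ᵥ w) x) := by
  simp [torusKernel, hrs]

theorem torusKernel_sub_one_self (α : (r : Fin k) → EuclideanSpace ℝ (V r))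
    (x : UnitAddTorus (Fin n)) (r : Fin k) :
    (torusKernel B V m α x - 1) r r = (∑ v : V r, ∑ w : V r,
      α r v * α r w * ((m r)⁻¹ * bilinB B v w * torusSin (B *ᵥ v) x * torusSin (B *ᵥ w) x)) - 1 := by
  simp [torusKernel]

/-- Almost surely every coefficient is at most √2 in absolute value, so the entry is bounded. Joint
integrability is what later permits exchanging the averages over ω and x. -/
theorem integrable_sq_torusKernel_sub_one [IsProbabilityMeasure P]
    (ha : ∀ r, HasLaw (a r) (uniformSphere (V r) (√2)) P)
    (r s : Fin k) :
    Integrable (fun p : Ω × UnitAddTorus (Fin n) =>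
      (torusKernel B V m (fun r => a r p.1) p.2 - 1) r s ^ 2) (P.prod volume) := by
  have hm : ∀ r (v : V r), AEMeasurable (fun p : Ω × UnitAddTorus (Fin n) => a r p.1 v)
      (P.prod volume) := fun r v =>
    ((by fun_prop : Measurable fun u : EuclideanSpace ℝ (V r) => u v).comp_aemeasurable
      (ha r).aemeasurable).comp_fst
  have hs : ∀ v : Fin n → ℝ, Measurable fun p : Ω × UnitAddTorus (Fin n) => torusSin v p.2 :=
    fun v => (measurable_torusSin v).comp measurable_snd
  have hmeas : AEMeasurable (fun p : Ω × UnitAddTorus (Fin n) =>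
      (torusKernel B V m (fun r => a r p.1) p.2 - 1) r s ^ 2) (P.prod volume) := by
    refine AEMeasurable.pow_const (AEMeasurable.sub_const ?_ _) 2
    simp only [torusKernel, Matrix.of_apply]
    refine Finset.aemeasurable_fun_sum _ fun v _ => Finset.aemeasurable_fun_sum _ fun w _ => ?_
    exact ((hm r v).mul (hm s w)).mul
      ((((hs _).const_mul _).mul (hs _)).aemeasurable)
  set K := ∑ v : V r, ∑ w : V s, |√2 * √2 * ((m r)⁻¹ * bilinB B v w)|
  refine (integrable_const ((K + 1) ^ 2)).mono' hmeas.aestronglyMeasurable ?_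
  have h1 : ∀ r, ∀ᵐ p : Ω × UnitAddTorus (Fin n) ∂(P.prod volume), ‖a r p.1‖ = √2 := fun r =>
    Measure.quasiMeasurePreserving_fst.ae
      (ae_norm_of_hasLaw_uniformSphere (Real.sqrt_nonneg 2) (ha r))
  filter_upwards [h1 r, h1 s] with p hr hs'
  rw [norm_pow, Real.norm_eq_abs]
  refine pow_le_pow_left₀ (abs_nonneg _) ?_ 2
  rw [Matrix.sub_apply]
  refine (abs_sub _ _).trans (add_le_add ?_ ?_)
  · simp only [torusKernel, Matrix.of_apply]
    refine (Finset.abs_sum_le_sum_abs _ _).trans (Finset.sum_le_sum fun v _ =>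
      (Finset.abs_sum_le_sum_abs _ _).trans (Finset.sum_le_sum fun w _ => ?_))
    have hv : |a r p.1 v| ≤ |√2| := by
      rw [abs_of_nonneg (Real.sqrt_nonneg 2), ← hr]
      exact PiLp.norm_apply_le (a r p.1) v
    have hw : |a s p.1 w| ≤ |√2| := by
      rw [abs_of_nonneg (Real.sqrt_nonneg 2), ← hs']
      exact PiLp.norm_apply_le (a s p.1) w
    simp only [abs_mul]
    have h3 := abs_torusSin_le_one (B *ᵥ v) p.2
    have h4 := abs_torusSin_le_one (B *ᵥ w) p.2
    calc |a r p.1 v| * |a s p.1 w| *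
          (|(m r)⁻¹| * |bilinB B v w| * |torusSin (B *ᵥ v) p.2| * |torusSin (B *ᵥ w) p.2|)
        ≤ |√2| * |√2| * (|(m r)⁻¹| * |bilinB B v w| * 1 * 1) := by gcongr
      _ = _ := by ring
  · rw [Matrix.one_apply]
    split_ifs <;> simp

theorem integral_sin_sq_mul_sin_sq_mulVec (hB : B.PosDef) {v w : Fin n → ℝ}
    (hv : IsIntegerVec (B *ᵥ v)) (hw : IsIntegerVec (B *ᵥ w)) (hvv : v + v ≠ 0) (hww : w + w ≠ 0)
    (hvw : v + w ≠ 0) : ∫ x, torusSin (B *ᵥ v) x ^ 2 * torusSin (B *ᵥ w) x ^ 2 =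
      1 / 4 + if v = w then 1 / 8 else 0 := by
  have hinj : Function.Injective (fun v => B *ᵥ v) :=
    Matrix.mulVec_injective_iff_isUnit.2 ((Matrix.isUnit_iff_isUnit_det B).2 hB.det_pos.ne'.isUnit)
  have h0 : ∀ z : Fin n → ℝ, z ≠ 0 → B *ᵥ z ≠ 0 := fun z hz h => hz <| hinj <| by simpa using h
  have h1 : ∀ z : Fin n → ℝ, z + z ≠ 0 → z ≠ 0 := fun z hz h => hz (by simp [h])
  rw [integral_torusSin_sq_mul_torusSin_sq hv hw (h0 _ (h1 _ hvv)) (h0 _ (h1 _ hww))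
    (by rw [← Matrix.mulVec_add]; exact h0 _ hvw)]
  simp only [hinj.eq_iff]

theorem integral_sin_sq_mulVec (hB : B.PosDef) {v : Fin n → ℝ}
    (hv : IsIntegerVec (B *ᵥ v)) (hvv : v + v ≠ 0) : ∫ x, torusSin (B *ᵥ v) x ^ 2 = 1 / 2 := by
  have hinj : Function.Injective (fun v => B *ᵥ v) :=
    Matrix.mulVec_injective_iff_isUnit.2 ((Matrix.isUnit_iff_isUnit_det B).2 hB.det_pos.ne'.isUnit)
  refine integral_torusSin_sq hv fun h => hvv ?_
  have : v = 0 := hinj (by simpa using h)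
  simp [this]

theorem integrable_sin_sq_mul_sin_sq (u v : Fin n → ℝ) :
    Integrable fun x => torusSin u x ^ 2 * torusSin v x ^ 2 := by
  refine (integrable_const (1 : ℝ)).mono' (by fun_prop) (Filter.Eventually.of_forall fun x => ?_)
  rw [norm_mul, norm_pow, norm_pow]
  exact mul_le_one₀ (pow_le_one₀ (norm_nonneg _) (abs_torusSin_le_one u x)) (by positivity)
    (pow_le_one₀ (norm_nonneg _) (abs_torusSin_le_one v x))

theorem integrable_sin_sq (u : Fin n → ℝ) : Integrable fun x => torusSin u x ^ 2 := by
  refine (integrable_const (1 : ℝ)).mono' (by fun_prop) (Filter.Eventually.of_forall fun x => ?_)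
  rw [norm_pow]
  exact pow_le_one₀ (norm_nonneg _) (abs_torusSin_le_one u x)

/-- The average over the coefficients at fixed x leaves integrals of sin² sin², which equal 1/4, or
3/8 for v = w. Off the diagonal of A this gives the bound at once. On the diagonal, m_r⁻¹⟨v, v⟩_B =
1 makes the terms of order one cancel. -/
theorem integral_integral_sq_torusKernel_sub_one_le (hB : B.PosDef)
    (hne : ∀ r, (V r).Nonempty) (hint : ∀ r, ∀ v ∈ V r, IsIntegerVec (B *ᵥ v))
    (hm : ∀ r, m r ≠ 0) (hmV : ∀ r, ∀ v ∈ V r, bilinB B v v = m r)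
    (hneg : ∀ r s, ∀ v ∈ V r, ∀ w ∈ V s, v + w ≠ 0)
    (ha : ∀ r, HasLaw (a r) (uniformSphere (V r) (√2)) P) (hindep : iIndepFun a P) (r s : Fin k) :
    ∫ x, ∫ ω, (torusKernel B V m (fun r => a r ω) x - 1) r s ^ 2 ∂P ≤
      (m r)⁻¹ ^ 2 * (2 / (((V r).card : ℝ) * ((V s).card : ℝ)) *
        ∑ v ∈ V r, ∑ w ∈ V s, bilinB B v w ^ 2) := by
  have hn : ∀ r, Nonempty (V r) := fun r => (hne r).to_subtype
  have hs2 : √2 ^ 2 = 2 := Real.sq_sqrt (by norm_num)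
  have hs4 : √2 ^ 4 = 4 := by
    rw [show √2 ^ 4 = (√2 ^ 2) ^ 2 by ring, hs2]
    norm_num
  have hI : ∀ r s (v : V r) (w : V s),
      ∫ x, torusSin (B *ᵥ v) x ^ 2 * torusSin (B *ᵥ w) x ^ 2 =
        1 / 4 + if (v : Fin n → ℝ) = w then 1 / 8 else 0 := fun r s v w =>
    integral_sin_sq_mul_sin_sq_mulVec hB (hint r v v.2) (hint s w w.2) (hneg r r v v.2 v v.2)
      (hneg s s w w.2 w w.2) (hneg r s v v.2 w w.2)
  have hi : ∀ r s (v : V r) (w : V s) (c : ℝ), Integrable fun x =>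
      c * (torusSin (B *ᵥ v) x ^ 2 * torusSin (B *ᵥ w) x ^ 2) := fun r s v w c =>
    (integrable_sin_sq_mul_sin_sq _ _).const_mul c
  have hsum : ∀ r s (c : V r → V s → ℝ), ∫ x, ∑ v : V r, ∑ w : V s,
      c v w * (torusSin (B *ᵥ v) x ^ 2 * torusSin (B *ᵥ w) x ^ 2) =
      ∑ v : V r, ∑ w : V s, c v w * (1 / 4 + if (v : Fin n → ℝ) = w then 1 / 8 else 0) := by
    intro r s c
    rw [integral_finsetSum _ fun v _ => integrable_finsetSum _ fun w _ => hi r s v w _]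
    refine Finset.sum_congr rfl fun v _ => ?_
    rw [integral_finsetSum _ fun w _ => hi r s v w _]
    refine Finset.sum_congr rfl fun w _ => ?_
    rw [integral_const_mul, hI]
  have hcoe : ∑ v ∈ V r, ∑ w ∈ V s, bilinB B v w ^ 2 =
      ∑ v : V r, ∑ w : V s, bilinB B v w ^ 2 := by
    rw [← Finset.sum_coe_sort]
    exact Finset.sum_congr rfl fun v _ => (Finset.sum_coe_sort (V s) fun w => bilinB B v w ^ 2).symm
  have hcard : ∀ r, (0 : ℝ) < (V r).card := fun r => by exact_mod_cast (hne r).card_pos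
  rw [hcoe]
  rcases eq_or_ne r s with rfl | hrs
  · simp only [torusKernel_sub_one_self]
    have e : ∀ x, ∫ ω, ((∑ v : V r, ∑ w : V r, a r ω v * a r ω w * ((m r)⁻¹ * bilinB B v w *
        torusSin (B *ᵥ v) x * torusSin (B *ᵥ w) x)) - 1) ^ 2 ∂P =
        (∑ v : V r, ∑ w : V r, (4 / ((V r).card * ((V r).card + 2)) *
          (1 + 2 * ((m r)⁻¹ * bilinB B v w) ^ 2)) *
          (torusSin (B *ᵥ v) x ^ 2 * torusSin (B *ᵥ w) x ^ 2)) -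
        (∑ v : V r, 4 / ((V r).card : ℝ) * torusSin (B *ᵥ v) x ^ 2) - (-1) := fun x => by
      rw [integral_sq_quadratic_sub_one_uniformSphere (Real.sqrt_nonneg 2) (ha r)
        (fun v w : V r => (m r)⁻¹ * bilinB B v w * torusSin (B *ᵥ v) x * torusSin (B *ᵥ w) x)
        fun v w => by rw [bilinB_comm hB.isHermitian]; ring]
      have h1 : ∀ v : V r, (m r)⁻¹ * bilinB B v v * torusSin (B *ᵥ v) x * torusSin (B *ᵥ v) x =
          torusSin (B *ᵥ v) x ^ 2 := fun v => by
        rw [hmV r v v.2, inv_mul_cancel₀ (hm r)]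
        ring
      simp only [h1, hs2, hs4, Fintype.card_coe]
      rw [Finset.mul_sum Finset.univ (fun v : V r => ∑ w : V r, _) 2, ← Finset.sum_add_distrib,
        Finset.mul_sum, Finset.mul_sum, Finset.mul_sum]
      rw [sub_neg_eq_add]
      congr 1
      congr 1
      · refine Finset.sum_congr rfl fun v _ => ?_
        rw [Finset.mul_sum, ← Finset.sum_add_distrib, Finset.mul_sum]
        exact Finset.sum_congr rfl fun w _ => by ring
      · exact Finset.sum_congr rfl fun w _ => by ring
    simp only [e]
    rw [integral_sub_sub (integrable_finsetSum _ fun v _ => integrable_finsetSum _ fun w _ =>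
      hi r r v w _) (integrable_finsetSum _ fun v _ => (integrable_sin_sq _).const_mul _)
      (integrable_const _), hsum, integral_finsetSum _ fun v _ => (integrable_sin_sq _).const_mul _]
    simp only [integral_const_mul]
    have h2 : ∑ v : V r, 4 / ((V r).card : ℝ) * ∫ x, torusSin (B *ᵥ v) x ^ 2 = 2 := by
      have h3 : ∀ v : V r, ∫ x, torusSin (B *ᵥ v) x ^ 2 = 1 / 2 := fun v =>
        integral_sin_sq_mulVec hB (hint r v v.2) (hneg r r v v.2 v v.2)
      simp only [h3, Finset.sum_const, Finset.card_univ, Fintype.card_coe, nsmul_eq_mul]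
      have := (hcard r).ne'
      field_simp
      norm_num
    set N : ℝ := ((V r).card : ℝ)
    have hN : 0 < N := hcard r
    set S : ℝ := ∑ v : V r, ∑ w : V r, bilinB B v w ^ 2
    have hS : 0 ≤ S := Finset.sum_nonneg fun v _ => Finset.sum_nonneg fun w _ => sq_nonneg _
    have h4 : ∑ v : V r, ∑ w : V r, 4 / (N * (N + 2)) * (1 + 2 * ((m r)⁻¹ * bilinB B v w) ^ 2) *
        (1 / 4 + if (v : Fin n → ℝ) = w then 1 / 8 else 0) =
        4 / (N * (N + 2)) * (N ^ 2 / 4 + 3 * N / 8 + (m r)⁻¹ ^ 2 * S / 2) := by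
      -- For v = w the left side is 3 · 3/8 = 9/8, and the general expression accounts for 1/4 + 1/2
      -- of it; the correction 3/8 is the rest.
      have h5 : ∀ v w : V r, (1 + 2 * ((m r)⁻¹ * bilinB B v w) ^ 2) *
          (1 / 4 + if (v : Fin n → ℝ) = w then 1 / 8 else 0) =
          1 / 4 + (m r)⁻¹ ^ 2 * bilinB B v w ^ 2 / 2 + if v = w then 3 / 8 else 0 := fun v w => by
        simp only [Subtype.coe_inj]
        split_ifs with h
        · rw [← h, hmV r v v.2, inv_mul_cancel₀ (hm r), ← mul_pow, inv_mul_cancel₀ (hm r)]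
          norm_num
        · ring
      simp only [mul_assoc, ← Finset.mul_sum]
      congr 1
      simp only [h5, Finset.sum_add_distrib, ← Finset.sum_div, ← Finset.mul_sum]
      simp only [S, N, Finset.sum_const, Finset.card_univ, Fintype.card_coe, nsmul_eq_mul,
        Finset.sum_ite_eq, Finset.mem_univ, if_true]
      ring
    rw [h2, h4]
    simp only [integral_const, probReal_univ, one_smul]
    have h6 : 0 ≤ (m r)⁻¹ ^ 2 * S := by positivity
    rw [show (m r)⁻¹ ^ 2 * (2 / (N * N) * S) = 2 * ((m r)⁻¹ ^ 2 * S) / (N * N) by ring]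
    generalize (m r)⁻¹ ^ 2 * S = R at h6 ⊢
    -- After the cancellation the correction -N/2 is negative and may be dropped; enlarging 1/(N(N +
    -- 2)) to 1/N² then gives the claim.
    have h7 : 4 / (N * (N + 2)) * (N ^ 2 / 4 + 3 * N / 8 + R / 2) - 2 - -1 =
        (2 * R - N / 2) / (N * (N + 2)) := by
      field_simp
      ring
    rw [h7]
    exact div_le_div₀ (by positivity) (by linarith) (by positivity) (by nlinarith)
  · simp only [torusKernel_sub_one_of_ne _ _ hrs]
    have e : ∀ x, ∫ ω, (∑ v : V r, ∑ w : V s, a r ω v * a s ω w * ((m r)⁻¹ * bilinB B v w *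
        torusSin (B *ᵥ v) x * torusSin (B *ᵥ w) x)) ^ 2 ∂P =
        ∑ v : V r, ∑ w : V s, (4 / ((V r).card * (V s).card) * ((m r)⁻¹ * bilinB B v w) ^ 2) *
          (torusSin (B *ᵥ v) x ^ 2 * torusSin (B *ᵥ w) x ^ 2) := fun x => by
      rw [integral_sq_bilinear_uniformSphere (Real.sqrt_nonneg 2) (ha r) (ha s)
        (hindep.indepFun hrs) (fun (v : V r) (w : V s) =>
          (m r)⁻¹ * bilinB B v w * torusSin (B *ᵥ v) x * torusSin (B *ᵥ w) x)]
      simp only [hs4, Fintype.card_coe, Finset.mul_sum]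
      exact Finset.sum_congr rfl fun v _ => Finset.sum_congr rfl fun w _ => by ring
    simp only [e]
    rw [hsum]
    simp only [Finset.mul_sum]
    refine Finset.sum_le_sum fun v _ => Finset.sum_le_sum fun w _ => ?_
    -- The crude bound 1/2 turns the factor √2⁴ = 4 into the 2 of the claim.
    have h1 : (1 / 4 + if (v : Fin n → ℝ) = w then 1 / 8 else 0 : ℝ) ≤ 1 / 2 := by
      split_ifs <;> norm_num
    have h2 := hcard r
    have h3 := hcard s
    refine (mul_le_mul_of_nonneg_left h1 (by positivity)).trans_eq ?_
    ring

end SecondMoment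

/-! ### Measurability and the averaged bound -/

section Main

variable {n k : ℕ}

/-- Dominated convergence: near α₀ the vector F is bounded uniformly in x, and g grows at most
linearly. -/
theorem continuous_integral_comp_torusVec (B : Matrix (Fin n) (Fin n) ℝ)
    (V : Fin k → Finset (Fin n → ℝ)) {g : EuclideanSpace ℝ (Fin k) → ℝ} (hg : LipschitzWith 1 g) :
    Continuous fun α : (r : Fin k) → EuclideanSpace ℝ (V r) => ∫ x, g (torusVec B V α x) := by
  refine continuous_iff_continuousAt.2 fun α₀ => ?_
  have hc : Continuous fun α : (r : Fin k) → EuclideanSpace ℝ (V r) =>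
      ∑ r, ∑ v : V r, |α r v| := by fun_prop
  have hev := hc.continuousAt.eventually (gt_mem_nhds (lt_add_one (∑ r, ∑ v : V r, |α₀ r v|)))
  refine continuousAt_of_dominated
    (bound := fun _ => |g 0| + ((∑ r, ∑ v : V r, |α₀ r v|) + 1))
    (Filter.Eventually.of_forall fun α =>
      (hg.continuous.measurable.comp (measurable_torusVec B V α)).aestronglyMeasurable)
    ?_ (integrable_const _) (Filter.Eventually.of_forall fun x => ?_)
  · filter_upwards [hev] with α hα
    refine Filter.Eventually.of_forall fun x => ?_
    have h1 := hg.dist_le_mul (torusVec B V α x) 0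
    rw [Real.dist_eq, dist_zero_right, NNReal.coe_one, one_mul] at h1
    have h2 := norm_torusVec_le B V α x
    rw [Real.norm_eq_abs]
    linarith [abs_sub_abs_le_abs_sub (g (torusVec B V α x)) (g 0)]
  · refine Continuous.continuousAt (hg.continuous.comp ((PiLp.continuous_toLp 2 _).comp
      (continuous_pi fun r => ?_)))
    simp only [torusFun_eq_sum]
    fun_prop

/-- The supremum runs over uncountably many test functions, so measurability of each term is not
enough; but a supremum of continuous functions is lower semicontinuous. -/
theorem measurable_wassersteinDist_torusVec (B : Matrix (Fin n) (Fin n) ℝ)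
    (V : Fin k → Finset (Fin n → ℝ)) (γ : Measure (EuclideanSpace ℝ (Fin k))) :
    Measurable fun α : (r : Fin k) → EuclideanSpace ℝ (V r) =>
      wassersteinDist ((volume : Measure (UnitAddTorus (Fin n))).map (torusVec B V α)) γ := by
  refine LowerSemicontinuous.measurable (lowerSemicontinuous_iSup fun g =>
    lowerSemicontinuous_iSup fun hg => Continuous.lowerSemicontinuous ?_)
  refine ENNReal.continuous_ofReal.comp (continuous_abs.comp (Continuous.sub ?_ continuous_const))
  simp only [integral_map (measurable_torusVec B V _).aemeasurable
    hg.continuous.aestronglyMeasurable]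
  exact continuous_integral_comp_torusVec B V hg

/-- The distance is at most the mean over x of ‖A - 1‖. Applying (𝔼Y)² ≤ 𝔼Y² first in x and then in
ω moves the square root outside both averages; Fubini then allows averaging over ω first. -/
theorem lintegral_wassersteinDist_torusVec_le {Ω : Type*} [MeasurableSpace Ω] {P : Measure Ω}
    [IsProbabilityMeasure P] {B : Matrix (Fin n) (Fin n) ℝ} {V : Fin k → Finset (Fin n → ℝ)}
    {m : Fin k → ℝ} {a : (r : Fin k) → Ω → EuclideanSpace ℝ (V r)} (hB : B.PosDef)
    (hne : ∀ r, (V r).Nonempty) (hint : ∀ r, ∀ v ∈ V r, IsIntegerVec (B *ᵥ v))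
    (hm : ∀ r, m r ≠ 0) (hmV : ∀ r, ∀ v ∈ V r, bilinB B v v = m r)
    (hneg : ∀ r s, ∀ v ∈ V r, ∀ w ∈ V s, v + w ≠ 0)
    (ha : ∀ r, HasLaw (a r) (uniformSphere (V r) (√2)) P) (hindep : iIndepFun a P) :
    ∫⁻ ω, wassersteinDist ((volume : Measure (UnitAddTorus (Fin n))).map
      (torusVec B V fun r => a r ω)) (stdGaussian (EuclideanSpace ℝ (Fin k))) ∂P ≤
    ENNReal.ofReal (√(∑ r, ∑ s, (m r)⁻¹ ^ 2 * (2 / (((V r).card : ℝ) * ((V s).card : ℝ)) *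
      ∑ v ∈ V r, ∑ w ∈ V s, bilinB B v w ^ 2))) := by
  let Φ : Ω × UnitAddTorus (Fin n) → ℝ := fun p =>
    ∑ r, ∑ s, (torusKernel B V m (fun r => a r p.1) p.2 - 1) r s ^ 2
  have hφ := fun r s => integrable_sq_torusKernel_sub_one (B := B) (m := m) ha r s
  have hΦ : Integrable Φ (P.prod volume) :=
    integrable_finsetSum _ fun r _ => integrable_finsetSum _ fun s _ => hφ r s
  have hΦ0 : ∀ p, 0 ≤ Φ p := fun p =>
    Finset.sum_nonneg fun r _ => Finset.sum_nonneg fun s _ => sq_nonneg _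
  let J : Ω → ℝ := fun ω => ∫ x, Φ (ω, x)
  have hJ0 : ∀ ω, 0 ≤ J ω := fun ω => integral_nonneg fun x => hΦ0 _
  have hJ : Integrable J P := hΦ.integral_prod_left
  have hJsqrt : MemLp (fun ω => √(J ω)) 2 P := by
    refine (memLp_two_iff_integrable_sq
      (Real.continuous_sqrt.comp_aestronglyMeasurable hJ.aestronglyMeasurable)).2 ?_
    simpa only [Real.sq_sqrt (hJ0 _)] using hJ
  have hK := fun ω => isSteinKernel_torusVec hB hint hm hmV fun r => a r ω
  have hpt : ∀ ω, wassersteinDist ((volume : Measure (UnitAddTorus (Fin n))).map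
      (torusVec B V fun r => a r ω)) (stdGaussian (EuclideanSpace ℝ (Fin k))) ≤
      ENNReal.ofReal (√(J ω)) := fun ω => by
    refine (hK ω).wassersteinDist_le.trans (ENNReal.ofReal_le_ofReal ?_)
    refine Real.le_sqrt_of_sq_le ((sq_integral_le_integral_sq
      (memLp_steinDiscrepancy (hK ω))).trans_eq ?_)
    congr 1 with x
    exact Real.sq_sqrt (hΦ0 (ω, x))
  refine (lintegral_mono hpt).trans ?_
  rw [← ofReal_integral_eq_lintegral_ofReal (hJsqrt.integrable one_le_two)
    (Filter.Eventually.of_forall fun ω => Real.sqrt_nonneg _)]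
  refine ENNReal.ofReal_le_ofReal (Real.le_sqrt_of_sq_le
    ((sq_integral_le_integral_sq hJsqrt).trans ?_))
  simp only [Real.sq_sqrt (hJ0 _), J]
  rw [integral_integral_swap (f := fun ω x => Φ (ω, x)) hΦ]
  -- Joint integrability gives integrability in ω only for almost every x, so the sums are exchanged
  -- with the integral almost everywhere.
  have hsw : ∀ᵐ x ∂(volume : Measure (UnitAddTorus (Fin n))), ∫ ω, Φ (ω, x) ∂P =
      ∑ r, ∑ s, ∫ ω, (torusKernel B V m (fun r => a r ω) x - 1) r s ^ 2 ∂P := by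
    have h1 : ∀ᵐ x ∂(volume : Measure (UnitAddTorus (Fin n))), ∀ r s, Integrable (fun ω =>
        (torusKernel B V m (fun r => a r ω) x - 1) r s ^ 2) P :=
      ae_all_iff.2 fun r => ae_all_iff.2 fun s => (hφ r s).prod_left_ae
    filter_upwards [h1] with x hx
    rw [integral_finsetSum _ fun r _ => integrable_finsetSum _ fun s _ => hx r s]
    exact Finset.sum_congr rfl fun r _ => integral_finsetSum _ fun s _ => hx r s
  rw [integral_congr_ae hsw, integral_finsetSum _ fun r _ => integrable_finsetSum _ fun s _ =>
    (hφ r s).integral_prod_right]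
  refine Finset.sum_le_sum fun r _ => ?_
  rw [integral_finsetSum _ fun s _ => (hφ r s).integral_prod_right]
  exact Finset.sum_le_sum fun s _ =>
    integral_integral_sq_torusKernel_sub_one_le hB hne hint hm hmV hneg ha hindep r s

end Main

theorem mainTheorem6 {n k : ℕ} (hk : 0 < k)
    -- the flat metric
    (B : Matrix (Fin n) (Fin n) ℝ) (hB : B.PosDef)
    -- the frequency sets and the eigenvalues
    (V : Fin k → Finset (Fin n → ℝ)) (μ : Fin k → ℝ)
    (hne : ∀ r, (V r).Nonempty)
    (hint : ∀ r, ∀ v ∈ V r, ∀ i, ∃ m : ℤ, (B *ᵥ v) i = m)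
    (hμ : ∀ r, ∀ v ∈ V r, bilinB B v v = μ r / (2 * Real.pi) ^ 2)
    (hneg : ∀ r s, ∀ v ∈ V r, ∀ w ∈ V s, v + w ≠ 0)
    (hdisj : ∀ r s, r ≠ s → Disjoint (V r) (V s))
    -- the random coefficients
    {Ω : Type*} [MeasurableSpace Ω] (P : Measure Ω) [IsProbabilityMeasure P]
    (a : (r : Fin k) → Ω → EuclideanSpace ℝ (V r))
    (ha : ∀ r, HasLaw (a r) (uniformSphere (V r) (Real.sqrt 2)) P)
    (hindep : iIndepFun a P)
    -- the uniformly distributed random point of the torus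
    {Ω' : Type*} [MeasurableSpace Ω'] (Q : Measure Ω') [IsProbabilityMeasure Q]
    (X : Ω' → UnitAddTorus (Fin n)) (hX : HasLaw X volume Q) :
    -- the functions are eigenfunctions of the Laplacian
    (∀ (ω : Ω) (r : Fin k) (y : Fin n → ℝ),
      flatLaplacian B (fun z => torusFun B (V r) (a r ω) (torusProj z)) y =
        -μ r * torusFun B (V r) (a r ω) (torusProj y)) ∧
    -- they are almost surely orthonormal
    (∀ᵐ ω ∂P, ∀ r s : Fin k,
      ∫ x, torusFun B (V r) (a r ω) x * torusFun B (V s) (a s ω) x = if r = s then 1 else 0) ∧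
    -- the averaged Wasserstein bound
    AEMeasurable (fun ω => wassersteinDist
      (Q.map fun ω' => WithLp.toLp 2 fun r => torusFun B (V r) (a r ω) (X ω'))
      (stdGaussian (EuclideanSpace ℝ (Fin k)))) P ∧
    ∫⁻ ω, wassersteinDist
      (Q.map fun ω' => WithLp.toLp 2 fun r => torusFun B (V r) (a r ω) (X ω'))
      (stdGaussian (EuclideanSpace ℝ (Fin k))) ∂P ≤
      ENNReal.ofReal (4 * Real.pi ^ 2 / (⨅ r, μ r) *
        Real.sqrt (∑ r, ∑ s, 2 / (((V r).card : ℝ) * ((V s).card : ℝ)) *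
          ∑ v ∈ V r, ∑ w ∈ V s, bilinB B v w ^ 2)) := by
  have : Nonempty (Fin k) := ⟨⟨0, hk⟩⟩
  have hmap : ∀ ω, (Q.map fun ω' => WithLp.toLp 2 fun r => torusFun B (V r) (a r ω) (X ω')) =
      (volume : Measure (UnitAddTorus (Fin n))).map (torusVec B V fun r => a r ω) := fun ω => by
    rw [← hX.map_eq, AEMeasurable.map_map_of_aemeasurable
      (measurable_torusVec B V _).aemeasurable hX.aemeasurable]
    rfl
  have hμpos : ∀ r, 0 < μ r := fun r => by
    obtain ⟨v, hv⟩ := hne r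
    -- The condition v + w ≠ 0 with w = v excludes the zero frequency; positive definiteness then
    -- makes μ_r positive.
    have hv0 : v ≠ 0 := fun h => hneg r r v hv v hv (by simp [h])
    have h1 : 0 < bilinB B v v := by
      have := hB.dotProduct_mulVec_pos hv0
      rw [bilinB, dotProduct_comm]
      simpa using this
    rw [hμ r v hv] at h1
    exact (div_pos_iff_of_pos_right (by positivity)).1 h1
  refine ⟨fun ω r y => flatLaplacian_torusFun hB (V r) (hint r) (hμ r) (a r ω) y, ?_, ?_, ?_⟩
  · have hnorm : ∀ᵐ ω ∂P, ∀ r, ‖a r ω‖ = √2 := ae_all_iff.2 fun r =>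
      ae_norm_of_hasLaw_uniformSphere (Real.sqrt_nonneg 2) (ha r)
    filter_upwards [hnorm] with ω hω r s
    rw [integral_torusFun_mul_torusFun hB (hint r) (hint s) (hneg r s)]
    split_ifs with hrs
    · subst hrs
      simp only [Subtype.coe_inj, mul_ite, mul_zero, Finset.sum_ite_eq, Finset.mem_univ, if_true]
      -- The radius √2 is chosen for this: ∑ a_v² = 2 compensates the mean 1/2 of cos².
      have h1 := EuclideanSpace.real_norm_sq_eq (a r ω)
      rw [hω r, Real.sq_sqrt (by norm_num)] at h1
      rw [← Finset.sum_mul]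
      simp only [← sq, ← h1]
      norm_num
    · refine Finset.sum_eq_zero fun v _ => Finset.sum_eq_zero fun w _ => ?_
      rw [if_neg, mul_zero]
      exact fun h => Finset.disjoint_left.1 (hdisj r s hrs) v.2 (h ▸ w.2)
  · simp only [hmap]
    exact (measurable_wassersteinDist_torusVec B V _).comp_aemeasurable
      (aemeasurable_pi_lambda _ fun r => (ha r).aemeasurable)
  · simp only [hmap]
    have hm : ∀ r, μ r / (2 * Real.pi) ^ 2 ≠ 0 := fun r =>
      (div_pos (hμpos r) (by positivity)).ne'
    refine (lintegral_wassersteinDist_torusVec_le hB hne hint hm hμ hneg ha hindep).trans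
      (ENNReal.ofReal_le_ofReal ?_)
    -- The infimum over a finite nonempty index set is attained, hence positive. It serves to bound
    -- every m_r⁻¹ = 4π²/μ_r by 4π²/min μ, which can be taken out of the sum.
    obtain ⟨r₀, hr₀⟩ := exists_eq_ciInf_of_finite (f := μ)
    have hinf : 0 < ⨅ r, μ r := hr₀ ▸ hμpos r₀
    rw [← Real.sqrt_sq (by positivity : 0 ≤ 4 * Real.pi ^ 2 / (⨅ r, μ r)),
      ← Real.sqrt_mul (sq_nonneg _)]
    refine Real.sqrt_le_sqrt ?_
    rw [Finset.mul_sum]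
    refine Finset.sum_le_sum fun r _ => ?_
    rw [Finset.mul_sum]
    refine Finset.sum_le_sum fun s _ => ?_
    have h2 : (μ r / (2 * Real.pi) ^ 2)⁻¹ ≤ 4 * Real.pi ^ 2 / (⨅ r, μ r) := by
      rw [inv_div, show (2 * Real.pi) ^ 2 = 4 * Real.pi ^ 2 by ring]
      exact div_le_div_of_nonneg_left (by positivity) hinf (ciInf_le (Finite.bddBelow_range μ) r)
    have h3 : 0 ≤ (μ r / (2 * Real.pi) ^ 2)⁻¹ :=
      inv_nonneg.2 (div_nonneg (hμpos r).le (by positivity))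
    refine mul_le_mul_of_nonneg_right (pow_le_pow_left₀ h3 h2 2) ?_
    exact mul_nonneg (by positivity)
      (Finset.sum_nonneg fun v _ => Finset.sum_nonneg fun w _ => sq_nonneg _)
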